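/- Let $\mathcal V$ be a complex $*$-vector space, and for each $n$ let $M_n(\mathcal V)$ be the space of $n\times n$ matrices over $\mathcal V$, with involution $[v_{ij}]^*=[v_{ji}^*]$. A *matrix order unit space* $(\mathcal V,1)$ is such a $\mathcal V$ together with convex cones $M_n(\mathcal V)^+\subseteq M_n(\mathcal V)$ of self-adjoint elements satisfying $\gamma^*M_n(\mathcal V)^+\gamma\subseteq M_m(\mathcal V)^+$ for all scalar $n\times m$ matrices $\gamma$, and an element $1$, such that $\mathcal V^+=M_1(\mathcal V)^+$ is a proper cone with order unit $1$ and every cone $M_n(\mathcal V)^+$ is Archimedean. Give $M_n(\mathcal V)$ the norm $$\|v\|_n=\inf\left\{t\in\mathbb R:\begin{bmatrix}t1_n&v\\ v^*&t1_n\end{bmatrix}\ge 0\right\};$$ $\mathcal V$ need not be complete. Scalar matrices carry the operator norm. A *matrix Lipschitz seminorm* $\mathcal L=(L_n)$ on $(\mathcal V,1)$ is a sequence of seminorms $L_n:M_n(\mathcal V)\to[0,\infty)$ such that, for all $v\in M_m(\mathcal V)$, $w\in M_n(\mathcal V)$ and scalar matrices $\alpha\in M_{n,m}$, $\beta\in M_{m,n}$: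 the null space of $L_n$ is $M_n(\mathbb C1)$; $L_{m+n}(v\oplus w)=\max\{L_m(v),L_n(w)\}$; $L_n(\alpha v\beta)\le\|\alpha\|L_m(v)\|\beta\|$; and $L_m(v^*)=L_m(v)$. It is *lower semicontinuous* if each $L_n$ is lower semicontinuous for the norm topology of $M_n(\mathcal V)$. Let $CS_n(\mathcal V)$ be the set of completely bounded, completely positive linear maps $\varphi:\mathcal V\to M_n$ with $\varphi(1)=1_n$, and for $a=[a_{ij}]\in M_r(\mathcal V)$ put $\langle\langle\varphi,a\rangle\rangle=[\varphi(a_{ij})]\in M_{rn}$. For $\varphi,\psi\in CS_n(\mathcal V)$ define $$D_{L_n}(\varphi,\psi)=\sup\{\|\langle\langle\varphi,a\rangle\rangle-\langle\langle\psi,a\rangle\rangle\|:\ a\in M_r(\mathcal V),\ L_r(a)\le1,\ r\in\mathbb N\}\in[0,\infty],$$ and for $a\in M_n(\mathcal V)$ define $$L_{D_{L_n}}(a)=\sup\left\{\frac{\|\langle\langle\varphi,a\rangle\rangle-\langle\langle\psi,a\rangle\rangle\|}{D_{L_r}(\varphi,\psi)}:\ \varphi,\psi\in CS_r(\mathcal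 V),\ \varphi\ne\psi,\ r\in\mathbb N\right\}\in[0,\infty],$$ where a quotient with denominator $+\infty$ is $0$ and the supremum of the empty set is $0$. **Theorem.** Let $(\mathcal V,1)$ be a matrix order unit space and let $\mathcal L=(L_n)$ be a lower semicontinuous matrix Lipschitz seminorm on it. Then $\mathcal L_{\mathcal D_{\mathcal L}}=\mathcal L$, that is, $L_{D_{L_n}}(a)=L_n(a)$ for all $n\in\mathbb N$ and all $a\in M_n(\mathcal V)$. -/

import Mathlib

open scoped Matrix ENNReal Matrix.Norms.L2Operator ComplexOrder

/- Scalar matrices `Matrix m n ℂ` carry the operator norm of `B(ℂⁿ, ℂᵐ)` (scope `L2Operator`).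
`M_n(V)` is `Matrix (Fin n) (Fin n) V`; the involution on it is the conjugate transpose `vᴴ`.
The size `n = 0` is admitted, where `M_0(V)` is the zero space and all notions are trivial. -/

/-- The matrix product `α v β` of scalar matrices `α`, `β` with a matrix `v` over `V`. -/
def matAct {V : Type*} [AddCommGroup V] [Module ℂ V] {m p q n : ℕ}
    (α : Matrix (Fin m) (Fin p) ℂ) (v : Matrix (Fin p) (Fin q) V)
    (β : Matrix (Fin q) (Fin n) ℂ) : Matrix (Fin m) (Fin n) V :=
  Matrix.of fun i j => ∑ k, ∑ l, (α i k * β l j) • v k l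

/-- The block matrix `[[a, b], [c, d]]`, as an element of `M_{m+n}(V)`. -/
def blockMat {V : Type*} {m n : ℕ}
    (a : Matrix (Fin m) (Fin m) V) (b : Matrix (Fin m) (Fin n) V)
    (c : Matrix (Fin n) (Fin m) V) (d : Matrix (Fin n) (Fin n) V) :
    Matrix (Fin (m + n)) (Fin (m + n)) V :=
  Matrix.reindex finSumFinEquiv finSumFinEquiv (Matrix.fromBlocks a b c d)

/-- The direct sum `v ⊕ w` in `M_{m+n}(V)`. -/
def matDirectSum {V : Type*} [AddCommGroup V] {m n : ℕ}
    (v : Matrix (Fin m) (Fin m) V) (w : Matrix (Fin n) (Fin n) V) :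
    Matrix (Fin (m + n)) (Fin (m + n)) V :=
  blockMat v 0 0 w

/-- The matrix pairing `≪φ, a≫ = [φ(a_ij)] ∈ M_{rn}` of a linear map `φ : V → M_n`, regarded as
an element of `M_n` of the dual space, with `a ∈ M_r(V)`. -/
def matPairing {V : Type*} [AddCommGroup V] [Module ℂ V] {n r : ℕ}
    (φ : V →ₗ[ℂ] Matrix (Fin n) (Fin n) ℂ) (a : Matrix (Fin r) (Fin r) V) :
    Matrix (Fin r × Fin n) (Fin r × Fin n) ℂ :=
  Matrix.of fun x y => φ (a x.1 y.1) x.2 y.2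

/-- A matrix ordering on a complex `*`-vector space `V`: a cone `M_n(V)⁺` of self-adjoint elements
in each `M_n(V)`, with `γ* M_n(V)⁺ γ ⊆ M_m(V)⁺` for every scalar `n × m` matrix `γ`. -/
structure MatrixOrder (V : Type*) [AddCommGroup V] [Module ℂ V] [StarAddMonoid V]
    [StarModule ℂ V] where
  pos : (n : ℕ) → PointedCone ℝ (Matrix (Fin n) (Fin n) V)
  isHermitian_of_mem : ∀ (n : ℕ), ∀ v ∈ pos n, v.IsHermitian
  conj_mem : ∀ (n m : ℕ) (γ : Matrix (Fin n) (Fin m) ℂ), ∀ v ∈ pos n, matAct γᴴ v γ ∈ pos m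

/-- A matrix order unit space structure on `V`: a matrix ordering with a distinguished order
unit `1` such that `V⁺ = M_1(V)⁺` is a proper cone and every `M_n(V)⁺` is Archimedean. -/
structure MatrixOrderUnitSpace (V : Type*) [AddCommGroup V] [Module ℂ V] [StarAddMonoid V]
    [StarModule ℂ V] extends MatrixOrder V where
  one : V
  proper : ∀ v : V, (Matrix.of fun _ _ => v) ∈ pos 1 → (Matrix.of fun _ _ => -v) ∈ pos 1 → v = 0
  one_pos : (Matrix.of fun _ _ => one) ∈ pos 1
  order_unit : ∀ v : V, star v = v →
    ∃ t : ℝ, 0 < t ∧ (Matrix.of fun _ _ => t • one - v) ∈ pos 1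
  archimedean : ∀ (n : ℕ) (v : Matrix (Fin n) (Fin n) V),
    (∀ t : ℝ, 0 < t → v + t • Matrix.diagonal (fun _ => one) ∈ pos n) → v ∈ pos n

namespace MatrixOrderUnitSpace

/-- The norm of `M_n(V)` given by the matrix order:
`‖v‖_n = inf {t ∈ ℝ : [[t 1_n, v], [v*, t 1_n]] ≥ 0}`. -/
noncomputable def matNorm {V : Type*} [AddCommGroup V] [Module ℂ V] [StarAddMonoid V]
    [StarModule ℂ V] (S : MatrixOrderUnitSpace V) {n : ℕ} (v : Matrix (Fin n) (Fin n) V) : ℝ :=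
  sInf {t : ℝ | blockMat (t • Matrix.diagonal fun _ => S.one) v vᴴ
    (t • Matrix.diagonal fun _ => S.one) ∈ S.pos (n + n)}

/-- The norm topology on `M_n(V)`: a set is open if it contains a ball around each of its
points. -/
@[reducible] def normTopology {V : Type*} [AddCommGroup V] [Module ℂ V] [StarAddMonoid V]
    [StarModule ℂ V] (S : MatrixOrderUnitSpace V) (n : ℕ) :
    TopologicalSpace (Matrix (Fin n) (Fin n) V) where
  IsOpen U := ∀ a ∈ U, ∃ ε : ℝ, 0 < ε ∧ ∀ b, S.matNorm (b - a) < ε → b ∈ U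
  isOpen_univ := fun _ _ => ⟨1, _root_.one_pos, fun _ _ => trivial⟩
  isOpen_inter := by
    intro U W hU hW a ha
    obtain ⟨ε, hε, h⟩ := hU a ha.1
    obtain ⟨δ, hδ, h'⟩ := hW a ha.2
    exact ⟨min ε δ, lt_min hε hδ, fun b hb =>
      ⟨h b (hb.trans_le (min_le_left _ _)), h' b (hb.trans_le (min_le_right _ _))⟩⟩
  isOpen_sUnion := by
    intro 𝒰 h𝒰 a ha
    obtain ⟨U, hU, haU⟩ := ha
    obtain ⟨ε, hε, h⟩ := h𝒰 U hU a haU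
    exact ⟨ε, hε, fun b hb => ⟨U, hU, h b hb⟩⟩

/-- `φ : V → M_n` is completely bounded. -/
def IsCompletelyBounded {V : Type*} [AddCommGroup V] [Module ℂ V] [StarAddMonoid V]
    [StarModule ℂ V] (S : MatrixOrderUnitSpace V) {n : ℕ}
    (φ : V →ₗ[ℂ] Matrix (Fin n) (Fin n) ℂ) : Prop :=
  ∃ C : ℝ, ∀ (r : ℕ) (a : Matrix (Fin r) (Fin r) V), ‖matPairing φ a‖ ≤ C * S.matNorm a

/-- `φ : V → M_n` is completely positive. -/
def IsCompletelyPositive {V : Type*} [AddCommGroup V] [Module ℂ V] [StarAddMonoid V]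
    [StarModule ℂ V] (S : MatrixOrderUnitSpace V) {n : ℕ}
    (φ : V →ₗ[ℂ] Matrix (Fin n) (Fin n) ℂ) : Prop :=
  ∀ (r : ℕ), ∀ a ∈ S.pos r, (matPairing φ a).PosSemidef

/-- The set `CS_n(V)` of matrix states: completely bounded, completely positive maps
`φ : V → M_n` with `φ(1) = 1_n`. -/
def MatrixState {V : Type*} [AddCommGroup V] [Module ℂ V] [StarAddMonoid V]
    [StarModule ℂ V] (S : MatrixOrderUnitSpace V) (n : ℕ) : Type _ :=
  {φ : V →ₗ[ℂ] Matrix (Fin n) (Fin n) ℂ //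
    S.IsCompletelyBounded φ ∧ S.IsCompletelyPositive φ ∧ φ S.one = 1}

/-- The gauges `L_{D_n}` determined by functions `D_r : CS_r(V) × CS_r(V) → [0, ∞]`:
`L_{D_n}(a) = sup {‖≪φ, a≫ - ≪ψ, a≫‖ / D_r(φ, ψ) : φ ≠ ψ in CS_r(V), r ∈ ℕ}`.
A quotient by `∞` is `0`. -/
noncomputable def lipGauge {V : Type*} [AddCommGroup V] [Module ℂ V] [StarAddMonoid V]
    [StarModule ℂ V] (S : MatrixOrderUnitSpace V)
    (D : (r : ℕ) → S.MatrixState r → S.MatrixState r → ℝ≥0∞)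
    (n : ℕ) (a : Matrix (Fin n) (Fin n) V) : ℝ≥0∞ :=
  ⨆ (r : ℕ) (φ : S.MatrixState r) (ψ : S.MatrixState r) (_ : φ ≠ ψ),
    ‖matPairing φ.1 a - matPairing ψ.1 a‖ₑ / D r φ ψ

end MatrixOrderUnitSpace

/-- A matrix Lipschitz seminorm on a matrix order unit space: a sequence of finite seminorms `L_n`
on `M_n(V)` such that the null space of `L_n` is `M_n(ℂ1)`, `L(v ⊕ w) = max (L v) (L w)`,
`L(α v β) ≤ ‖α‖ L(v) ‖β‖` and `L(v*) = L(v)`. -/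
structure MatrixLipschitzSeminorm {V : Type*} [AddCommGroup V] [Module ℂ V] [StarAddMonoid V]
    [StarModule ℂ V] (S : MatrixOrderUnitSpace V) where
  L : (n : ℕ) → Seminorm ℂ (Matrix (Fin n) (Fin n) V)
  eq_zero_iff : ∀ (n : ℕ) (v : Matrix (Fin n) (Fin n) V),
    L n v = 0 ↔ ∃ c : Matrix (Fin n) (Fin n) ℂ, v = c.map (fun z => z • S.one)
  map_directSum : ∀ (m n : ℕ) (v : Matrix (Fin m) (Fin m) V) (w : Matrix (Fin n) (Fin n) V),
    L (m + n) (matDirectSum v w) = max (L m v) (L n w)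
  map_matAct_le : ∀ (m n : ℕ) (α : Matrix (Fin n) (Fin m) ℂ) (v : Matrix (Fin m) (Fin m) V)
    (β : Matrix (Fin m) (Fin n) ℂ), L n (matAct α v β) ≤ ‖α‖ * L m v * ‖β‖
  map_conjTranspose : ∀ (n : ℕ) (v : Matrix (Fin n) (Fin n) V), L n vᴴ = L n v

namespace MatrixLipschitzSeminorm

/-- Each `L_n` is lower semicontinuous for the norm topology of `M_n(V)`. -/
def IsLowerSemicontinuous {V : Type*} [AddCommGroup V] [Module ℂ V] [StarAddMonoid V]
    [StarModule ℂ V] {S : MatrixOrderUnitSpace V} (𝓛 : MatrixLipschitzSeminorm S) : Prop :=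
  ∀ n : ℕ, letI := S.normTopology n; LowerSemicontinuous (𝓛.L n)

/-- The matrix metric `D_{L_n}(φ, ψ) = sup {‖≪φ, a≫ - ≪ψ, a≫‖ : a ∈ M_r(V), L_r(a) ≤ 1, r ∈ ℕ}`
on `CS_n(V)`, with values in `[0, ∞]`. -/
noncomputable def matrixMetric {V : Type*} [AddCommGroup V] [Module ℂ V] [StarAddMonoid V]
    [StarModule ℂ V] {S : MatrixOrderUnitSpace V} (𝓛 : MatrixLipschitzSeminorm S)
    (n : ℕ) (φ ψ : S.MatrixState n) : ℝ≥0∞ :=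
  ⨆ (r : ℕ) (a : Matrix (Fin r) (Fin r) V) (_ : 𝓛.L r a ≤ 1),
    ‖matPairing φ.1 a - matPairing ψ.1 a‖ₑ

end MatrixLipschitzSeminorm

/-!
The inequality `L_{D_L} ≤ L` is the definition of `D_L` after rescaling. For the converse it is
enough, by homogeneity, to find for every `a ∈ M_n(V)` with `L(a) > 1` two matrix states `φ`, `ψ`
and a `T > 0` such that `D_L(φ, ψ) ≤ 1 / T` while `‖≪φ, a≫ - ≪ψ, a≫‖ > 1 / T`.

Replacing `a` by `[[0, a], [a*, 0]]`, which has the same seminorm (`L_offDiag`), makes it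
self-adjoint. Consider the triples `(f₁, f₂, p)` of positive functionals on `M_n(V)`, `M_n(V)` and
`M_n(ℂ)` with

  `f₁(γ* v γ) - f₂(γ* v γ) ≤ p(γ* γ)`  whenever `L(v) ≤ 1`.

They are the functionals nonnegative on a cone in `M_n(V) × M_n(V) × M_n(ℂ)` with order unit
`(1, 1, 1)`; it is convex because `L(v ⊕ w) = max (L v) (L w)`. If none of them had
`f₁(a) - f₂(a) > p(1)`, then for every `ε > 0` there would be `w = γ* v γ` within `ε` of `a` in the
matrix order with `L(v) ≤ 1` and `γ* γ ≤ 1 + ε`, so `L(w) ≤ 1 + ε`, contradicting lower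
semicontinuity. M. Riesz's extension theorem therefore gives such a triple
(`exists_separating_functionals`). Carrying `f₁` and `f₂` separately through this one separation
argument replaces the bipolar theorem for matrix convex sets and the decomposition of completely
bounded maps.

Positive functionals on `M_n(V)` are completely positive maps `V → M_n` (`toMap`), and `p` is a
density matrix `P`, which may be taken invertible. Conjugation of the two maps by an inverse square
root of `P` turns the domination by `p` into a bound by `1` of the quadratic forms of `≪Φ₁ - Φ₂, v≫`
for `L(v) ≤ 1`, and, since `L` does not distinguish `v` from `[[0, v], [v*, 0]]`, into a bound by
`1` of their norms, while `‖≪Φ₁ - Φ₂, a≫‖ > 1` (`exists_separating_cp_maps`). As `L` vanishes on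
scalars, `Φ₁(1) = Φ₂(1)`; adding the same completely positive map to both makes their values at `1`
equal to a scalar `T`, and division by `T` gives `φ` and `ψ` (`exists_matrixState_sub_eq`).
-/

/-! ### Norms and quadratic forms of scalar matrices -/

namespace Matrix

variable {m n : Type*} [Fintype m] [Fintype n]

lemma re_star_dotProduct_eq_inner (x y : m → ℂ) :
    (star x ⬝ᵥ y).re = (inner ℂ (WithLp.toLp 2 x) (WithLp.toLp 2 y) : ℂ).re := by
  rw [EuclideanSpace.inner_toLp_toLp, dotProduct_comm]

lemma re_star_dotProduct_self (x : m → ℂ) : (star x ⬝ᵥ x).re = ‖WithLp.toLp 2 x‖ ^ 2 := by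
  rw [re_star_dotProduct_eq_inner, inner_self_eq_norm_sq_to_K]
  norm_cast

variable [DecidableEq n]

lemma norm_toLp_mulVec_le (A : Matrix m n ℂ) (x : n → ℂ) :
    ‖WithLp.toLp 2 (A *ᵥ x)‖ ≤ ‖A‖ * ‖WithLp.toLp 2 x‖ :=
  l2_opNorm_mulVec A (WithLp.toLp 2 x)

lemma norm_le_of_mulVec_le (A : Matrix m n ℂ) {c : ℝ} (hc : 0 ≤ c)
    (h : ∀ x : n → ℂ, ‖WithLp.toLp 2 (A *ᵥ x)‖ ≤ c * ‖WithLp.toLp 2 x‖) : ‖A‖ ≤ c := by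
  rw [l2_opNorm_def]
  exact ContinuousLinearMap.opNorm_le_bound _ hc fun x => h x.ofLp

lemma two_re_dotProduct_mulVec_le (A : Matrix m n ℂ) (x : m → ℂ) (y : n → ℂ) :
    2 * (star x ⬝ᵥ A *ᵥ y).re ≤ ‖A‖ * (‖WithLp.toLp 2 x‖ ^ 2 + ‖WithLp.toLp 2 y‖ ^ 2) := by
  have h1 : (star x ⬝ᵥ A *ᵥ y).re ≤ ‖WithLp.toLp 2 x‖ * (‖A‖ * ‖WithLp.toLp 2 y‖) := by
    rw [re_star_dotProduct_eq_inner]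
    refine (Complex.re_le_norm _).trans ((norm_inner_le_norm _ _).trans ?_)
    gcongr
    exact norm_toLp_mulVec_le A y
  nlinarith [mul_nonneg (norm_nonneg A) (sq_nonneg (‖WithLp.toLp 2 x‖ - ‖WithLp.toLp 2 y‖))]

lemma norm_le_of_two_re_le (A : Matrix m n ℂ) {c : ℝ} (hc : 0 ≤ c)
    (h : ∀ (x : m → ℂ) (y : n → ℂ), 2 * (star x ⬝ᵥ A *ᵥ y).re ≤
      c * (‖WithLp.toLp 2 x‖ ^ 2 + ‖WithLp.toLp 2 y‖ ^ 2)) : ‖A‖ ≤ c := by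
  refine norm_le_of_mulVec_le A hc fun y => ?_
  set z := A *ᵥ y with hz
  by_cases hz0 : ‖WithLp.toLp 2 z‖ = 0
  · rw [hz0]; positivity
  by_cases hy0 : ‖WithLp.toLp 2 y‖ = 0
  · have := norm_toLp_mulVec_le A y
    rw [hy0] at this ⊢
    simpa using this
  have hzp : 0 < ‖WithLp.toLp 2 z‖ := lt_of_le_of_ne (norm_nonneg _) (Ne.symm hz0)
  have hyp : 0 < ‖WithLp.toLp 2 y‖ := lt_of_le_of_ne (norm_nonneg _) (Ne.symm hy0)
  -- the multiple of `A y` whose norm is that of `y`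
  have h1 := h (((‖WithLp.toLp 2 y‖ / ‖WithLp.toLp 2 z‖ : ℝ) : ℂ) • z) y
  rw [star_smul, smul_dotProduct, ← hz, smul_eq_mul, Complex.star_def, Complex.conj_ofReal,
    Complex.re_ofReal_mul, re_star_dotProduct_self, WithLp.toLp_smul, norm_smul,
    Complex.norm_real, Real.norm_of_nonneg (by positivity), div_mul_cancel₀ _ hz0] at h1
  have h2 : ‖WithLp.toLp 2 y‖ / ‖WithLp.toLp 2 z‖ * ‖WithLp.toLp 2 z‖ ^ 2 =
      ‖WithLp.toLp 2 y‖ * ‖WithLp.toLp 2 z‖ := by field_simp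
  rw [h2] at h1
  nlinarith

omit [DecidableEq n] in
lemma posSemidef_of_re_nonneg {A : Matrix n n ℂ} (hA : A.IsHermitian)
    (h : ∀ x : n → ℂ, 0 ≤ (star x ⬝ᵥ A *ᵥ x).re) : A.PosSemidef :=
  .of_dotProduct_mulVec_nonneg hA fun x => by
    rw [Complex.nonneg_iff]
    exact ⟨h x, (hA.im_star_dotProduct_mulVec_self x).symm⟩

omit [DecidableEq n] in
lemma PosSemidef.re_nonneg {A : Matrix n n ℂ} (hA : A.PosSemidef) (x : n → ℂ) :
    0 ≤ (star x ⬝ᵥ A *ᵥ x).re :=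
  (Complex.nonneg_iff.1 (hA.dotProduct_mulVec_nonneg x)).1

lemma norm_sq_le_of_posSemidef {γ : Matrix m n ℂ} {c : ℝ} (hc : 0 ≤ c)
    (h : ((c : ℂ) • (1 : Matrix n n ℂ) - γᴴ * γ).PosSemidef) : ‖γ‖ * ‖γ‖ ≤ c := by
  have : ‖γ‖ ≤ √c := by
    refine norm_le_of_mulVec_le γ (Real.sqrt_nonneg c) fun x => ?_
    have h1 := h.re_nonneg x
    have h2 : star x ⬝ᵥ (γᴴ * γ) *ᵥ x = star (γ *ᵥ x) ⬝ᵥ (γ *ᵥ x) := by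
      rw [← mulVec_mulVec, dotProduct_mulVec, star_mulVec]
    rw [sub_mulVec, dotProduct_sub, smul_mulVec, one_mulVec, dotProduct_smul, h2, Complex.sub_re,
      smul_eq_mul, Complex.re_ofReal_mul, re_star_dotProduct_self, re_star_dotProduct_self] at h1
    refine le_of_sq_le_sq ?_ (by positivity)
    rw [mul_pow, Real.sq_sqrt hc]
    linarith
  calc ‖γ‖ * ‖γ‖ ≤ √c * √c := by gcongr
    _ = c := Real.mul_self_sqrt hc

lemma posSemidef_smul_one_sub {A : Matrix n n ℂ} (hA : A.IsHermitian) {c : ℝ} (hc : ‖A‖ ≤ c) :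
    ((c : ℂ) • (1 : Matrix n n ℂ) - A).PosSemidef := by
  refine posSemidef_of_re_nonneg (IsHermitian.sub ?_ hA) fun x => ?_
  · rw [IsHermitian, conjTranspose_smul, conjTranspose_one, Complex.star_def, Complex.conj_ofReal]
  · have h1 := two_re_dotProduct_mulVec_le A x x
    rw [sub_mulVec, dotProduct_sub, smul_mulVec, one_mulVec, dotProduct_smul, Complex.sub_re,
      smul_eq_mul, Complex.re_ofReal_mul, re_star_dotProduct_self]
    nlinarith [sq_nonneg ‖WithLp.toLp 2 x‖]

end Matrix

/-- The self-adjoint matrix `[[0, v], [v*, 0]]`. -/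
def offDiag {V : Type*} [AddCommGroup V] [Star V] {n : ℕ}
    (v : Matrix (Fin n) (Fin n) V) : Matrix (Fin (n + n)) (Fin (n + n)) V :=
  blockMat 0 v vᴴ 0

/-- The scalar matrix `[[0, 1], [1, 0]]`. -/
def swapMat (n : ℕ) : Matrix (Fin (n + n)) (Fin (n + n)) ℂ :=
  blockMat 0 1 1 0

section blockMat

variable {V : Type*} {m n : ℕ}
    (a : Matrix (Fin m) (Fin m) V) (b : Matrix (Fin m) (Fin n) V)
    (c : Matrix (Fin n) (Fin m) V) (d : Matrix (Fin n) (Fin n) V)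

@[simp] lemma blockMat_castAdd_castAdd (i j : Fin m) :
    blockMat a b c d (Fin.castAdd n i) (Fin.castAdd n j) = a i j := by simp [blockMat]

@[simp] lemma blockMat_castAdd_natAdd (i : Fin m) (j : Fin n) :
    blockMat a b c d (Fin.castAdd n i) (Fin.natAdd m j) = b i j := by simp [blockMat]

@[simp] lemma blockMat_natAdd_castAdd (i : Fin n) (j : Fin m) :
    blockMat a b c d (Fin.natAdd m i) (Fin.castAdd n j) = c i j := by simp [blockMat]

@[simp] lemma blockMat_natAdd_natAdd (i j : Fin n) :
    blockMat a b c d (Fin.natAdd m i) (Fin.natAdd m j) = d i j := by simp [blockMat]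

/-- Matrices of size `m + n` are equal if their four blocks are. -/
lemma ext_blocks {A B : Matrix (Fin (m + n)) (Fin (m + n)) V}
    (h₁ : ∀ i j, A (Fin.castAdd n i) (Fin.castAdd n j) = B (Fin.castAdd n i) (Fin.castAdd n j))
    (h₂ : ∀ i j, A (Fin.castAdd n i) (Fin.natAdd m j) = B (Fin.castAdd n i) (Fin.natAdd m j))
    (h₃ : ∀ i j, A (Fin.natAdd m i) (Fin.castAdd n j) = B (Fin.natAdd m i) (Fin.castAdd n j))
    (h₄ : ∀ i j, A (Fin.natAdd m i) (Fin.natAdd m j) = B (Fin.natAdd m i) (Fin.natAdd m j)) :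
    A = B := by
  ext i j
  refine Fin.addCases (fun i => ?_) (fun i => ?_) i <;>
    refine Fin.addCases (fun j => ?_) (fun j => ?_) j
  exacts [h₁ i j, h₂ i j, h₃ i j, h₄ i j]

lemma conjTranspose_blockMat [Star V] :
    (blockMat a b c d)ᴴ = blockMat aᴴ cᴴ bᴴ dᴴ := by
  apply ext_blocks <;> intro i j <;> simp [Matrix.conjTranspose_apply]

end blockMat

lemma one_eq_blockMat (m n : ℕ) :
    (1 : Matrix (Fin (m + n)) (Fin (m + n)) ℂ) = blockMat 1 0 0 1 := by
  rw [blockMat, Matrix.fromBlocks_one]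
  simp

lemma swapMat_mul_self (n : ℕ) : swapMat n * swapMat n = 1 := by
  rw [one_eq_blockMat]
  apply ext_blocks <;> intro i j <;>
    simp [swapMat, Matrix.mul_apply, Fin.sum_univ_add, Matrix.one_apply, -Fin.natAdd_eq_addNat]

lemma conjTranspose_swapMat (n : ℕ) : (swapMat n)ᴴ = swapMat n := by
  simp [swapMat, conjTranspose_blockMat]

lemma norm_one_matrix_le (n : ℕ) : ‖(1 : Matrix (Fin n) (Fin n) ℂ)‖ ≤ 1 :=
  Matrix.norm_le_of_mulVec_le _ zero_le_one fun x => by simp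

lemma norm_swapMat_le (n : ℕ) : ‖swapMat n‖ ≤ 1 := by
  have h := Matrix.l2_opNorm_conjTranspose_mul_self (swapMat n)
  rw [conjTranspose_swapMat, swapMat_mul_self] at h
  nlinarith [norm_one_matrix_le (n + n), norm_nonneg (swapMat n)]

/-- The column of two blocks `[γ; δ]`. -/
def stack {m p n : ℕ} (γ : Matrix (Fin m) (Fin n) ℂ) (δ : Matrix (Fin p) (Fin n) ℂ) :
    Matrix (Fin (m + p)) (Fin n) ℂ :=
  Matrix.of fun k => Fin.addCases (fun i => γ i) (fun i => δ i) k

lemma conjTranspose_stack_mul_stack {m p n : ℕ} (γ : Matrix (Fin m) (Fin n) ℂ)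
    (δ : Matrix (Fin p) (Fin n) ℂ) : (stack γ δ)ᴴ * stack γ δ = γᴴ * γ + δᴴ * δ := by
  ext i j
  simp [Matrix.mul_apply, stack, Fin.sum_univ_add]

/-! ### Scalar matrices acting on matrices over a vector space -/

section matAct

variable {V : Type*} [AddCommGroup V] [Module ℂ V] {m n p q : ℕ}

lemma matAct_zero (α : Matrix (Fin m) (Fin p) ℂ) (β : Matrix (Fin q) (Fin n) ℂ) :
    matAct α (0 : Matrix (Fin p) (Fin q) V) β = 0 := by
  ext i j
  simp [matAct]

lemma smul_matAct_smul (a b : ℂ) (α : Matrix (Fin m) (Fin p) ℂ) (v : Matrix (Fin p) (Fin q) V)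
    (β : Matrix (Fin q) (Fin n) ℂ) : matAct (a • α) v (b • β) = (a * b) • matAct α v β := by
  ext i j
  simp only [matAct, Matrix.of_apply, Matrix.smul_apply, Finset.smul_sum, smul_smul, smul_eq_mul]
  refine Finset.sum_congr rfl fun k _ => Finset.sum_congr rfl fun l _ => ?_
  ring_nf

lemma matAct_scalar (α : Matrix (Fin m) (Fin p) ℂ) (v : Matrix (Fin p) (Fin q) ℂ)
    (β : Matrix (Fin q) (Fin n) ℂ) : matAct α v β = α * v * β := by
  ext i j
  simp only [matAct, Matrix.of_apply, Matrix.mul_apply, Finset.sum_mul, smul_eq_mul]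
  rw [Finset.sum_comm]
  refine Finset.sum_congr rfl fun k _ => Finset.sum_congr rfl fun l _ => ?_
  ring

/-- The compression of a direct sum by a column of two blocks is the sum of the compressions. -/
lemma matAct_matDirectSum (v : Matrix (Fin m) (Fin m) V) (w : Matrix (Fin p) (Fin p) V)
    (γ : Matrix (Fin m) (Fin n) ℂ) (δ : Matrix (Fin p) (Fin n) ℂ) :
    matAct (stack γ δ)ᴴ (matDirectSum v w) (stack γ δ) = matAct γᴴ v γ + matAct δᴴ w δ := by
  ext i j
  simp [matAct, matDirectSum, stack, Fin.sum_univ_add, Matrix.conjTranspose_apply]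

lemma matAct_one_swapMat [StarAddMonoid V] (v : Matrix (Fin n) (Fin n) V) :
    matAct 1 (matDirectSum v vᴴ) (swapMat n) = offDiag v := by
  rw [one_eq_blockMat]
  apply ext_blocks <;> intro i j <;>
    simp [matAct, swapMat, offDiag, matDirectSum, Fin.sum_univ_add, Matrix.one_apply, ite_smul,
      -Fin.natAdd_eq_addNat]

lemma matAct_one_offDiag_swapMat [StarAddMonoid V] (v : Matrix (Fin n) (Fin n) V) :
    matAct 1 (offDiag v) (swapMat n) = matDirectSum v vᴴ := by
  rw [one_eq_blockMat]
  apply ext_blocks <;> intro i j <;>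
    simp [matAct, swapMat, offDiag, matDirectSum, Fin.sum_univ_add, Matrix.one_apply, ite_smul,
      -Fin.natAdd_eq_addNat]

omit [Module ℂ V] in
lemma isHermitian_offDiag [StarAddMonoid V] (v : Matrix (Fin n) (Fin n) V) :
    (offDiag v).IsHermitian := by
  rw [Matrix.IsHermitian, offDiag, conjTranspose_blockMat]
  simp

end matAct

/-! ### The pairing of a map into matrices with a matrix -/

section matPairing

variable {V : Type*} [AddCommGroup V] [Module ℂ V] {n r : ℕ}

lemma matPairing_add_left (φ ψ : V →ₗ[ℂ] Matrix (Fin n) (Fin n) ℂ) (a : Matrix (Fin r) (Fin r) V) :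
    matPairing (φ + ψ) a = matPairing φ a + matPairing ψ a := by
  ext; simp [matPairing]

lemma matPairing_sub_left (φ ψ : V →ₗ[ℂ] Matrix (Fin n) (Fin n) ℂ) (a : Matrix (Fin r) (Fin r) V) :
    matPairing (φ - ψ) a = matPairing φ a - matPairing ψ a := by
  ext; simp [matPairing]

lemma matPairing_smul_left (c : ℂ) (φ : V →ₗ[ℂ] Matrix (Fin n) (Fin n) ℂ)
    (a : Matrix (Fin r) (Fin r) V) : matPairing (c • φ) a = c • matPairing φ a := by
  ext; simp [matPairing]

lemma matPairing_smul (φ : V →ₗ[ℂ] Matrix (Fin n) (Fin n) ℂ) (c : ℂ)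
    (a : Matrix (Fin r) (Fin r) V) : matPairing φ (c • a) = c • matPairing φ a := by
  ext; simp [matPairing]

lemma matPairing_conjTranspose [Star V] {φ : V →ₗ[ℂ] Matrix (Fin n) (Fin n) ℂ}
    (hφ : ∀ v, φ (star v) = (φ v)ᴴ) (a : Matrix (Fin r) (Fin r) V) :
    matPairing φ aᴴ = (matPairing φ a)ᴴ := by
  ext; simp [matPairing, hφ, Matrix.conjTranspose_apply]

/-- The quadratic form of `≪φ, a≫` is a double sum over the two indices of a vector. -/
lemma dotProduct_matPairing_mulVec (φ : V →ₗ[ℂ] Matrix (Fin n) (Fin n) ℂ)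
    (a : Matrix (Fin r) (Fin r) V) (x y : Fin r × Fin n → ℂ) :
    star x ⬝ᵥ matPairing φ a *ᵥ y =
      ∑ k, ∑ l, star (fun i => x (k, i)) ⬝ᵥ φ (a k l) *ᵥ (fun j => y (l, j)) := by
  simp only [dotProduct, Matrix.mulVec, matPairing, Matrix.of_apply, Fintype.sum_prod_type,
    Pi.star_apply, Finset.mul_sum]
  refine Finset.sum_congr rfl fun k _ => ?_
  rw [Finset.sum_comm]

/-- The vector with blocks `x` and `y`. -/
def blockVec (x y : Fin r × Fin n → ℂ) : Fin (r + r) × Fin n → ℂ :=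
  fun p => Fin.addCases (fun k => x (k, p.2)) (fun k => y (k, p.2)) p.1

lemma norm_sq_blockVec (x y : Fin r × Fin n → ℂ) :
    ‖WithLp.toLp 2 (blockVec x y)‖ ^ 2 = ‖WithLp.toLp 2 x‖ ^ 2 + ‖WithLp.toLp 2 y‖ ^ 2 := by
  simp [EuclideanSpace.norm_sq_eq, Fintype.sum_prod_type, Fin.sum_univ_add, blockVec,
    -Fin.natAdd_eq_addNat]

lemma dotProduct_matPairing_blockMat (φ : V →ₗ[ℂ] Matrix (Fin n) (Fin n) ℂ)
    (a b c d : Matrix (Fin r) (Fin r) V) (x y : Fin r × Fin n → ℂ) :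
    star (blockVec x y) ⬝ᵥ matPairing φ (blockMat a b c d) *ᵥ blockVec x y =
      star x ⬝ᵥ matPairing φ a *ᵥ x + star x ⬝ᵥ matPairing φ b *ᵥ y +
      (star y ⬝ᵥ matPairing φ c *ᵥ x + star y ⬝ᵥ matPairing φ d *ᵥ y) := by
  simp only [dotProduct_matPairing_mulVec, Fin.sum_univ_add, blockVec, blockMat_castAdd_castAdd,
    blockMat_castAdd_natAdd, blockMat_natAdd_castAdd, blockMat_natAdd_natAdd, Fin.addCases_left,
    Fin.addCases_right, Finset.sum_add_distrib]
  abel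

lemma re_dotProduct_conjTranspose {ι : Type*} [Fintype ι] (A : Matrix ι ι ℂ) (x y : ι → ℂ) :
    (star y ⬝ᵥ Aᴴ *ᵥ x).re = (star x ⬝ᵥ A *ᵥ y).re := by
  have : star (star x ⬝ᵥ A *ᵥ y) = star y ⬝ᵥ Aᴴ *ᵥ x := by
    rw [← Matrix.star_dotProduct_star, star_star, Matrix.star_mulVec, ← Matrix.dotProduct_mulVec]
  rw [← this]; rfl

lemma matPairing_zero_right (φ : V →ₗ[ℂ] Matrix (Fin n) (Fin n) ℂ) :
    matPairing φ (0 : Matrix (Fin r) (Fin r) V) = 0 := by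
  ext; simp [matPairing]

/-- The quadratic form of `≪φ, [[0, v], [v*, 0]]≫` is twice the real part of the sesquilinear form
of `≪φ, v≫`. -/
lemma re_dotProduct_matPairing_offDiag [StarAddMonoid V]
    {φ : V →ₗ[ℂ] Matrix (Fin n) (Fin n) ℂ}
    (hφ : ∀ v, φ (star v) = (φ v)ᴴ) (v : Matrix (Fin r) (Fin r) V) (x y : Fin r × Fin n → ℂ) :
    (star (blockVec x y) ⬝ᵥ matPairing φ (offDiag v) *ᵥ blockVec x y).re =
      2 * (star x ⬝ᵥ matPairing φ v *ᵥ y).re := by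
  rw [offDiag, dotProduct_matPairing_blockMat, matPairing_conjTranspose hφ]
  simp only [matPairing_zero_right, Complex.add_re, re_dotProduct_conjTranspose, Matrix.zero_mulVec,
    dotProduct_zero, Complex.zero_re]
  ring

/-- A bound for the quadratic form of `≪φ, [[0, v], [v*, 0]]≫` is a bound for the norm of `≪φ, v≫`,
with no loss of a constant. -/
lemma norm_matPairing_le_one_of_offDiag [StarAddMonoid V]
    {φ : V →ₗ[ℂ] Matrix (Fin n) (Fin n) ℂ}
    (hφ : ∀ v, φ (star v) = (φ v)ᴴ) (v : Matrix (Fin r) (Fin r) V)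
    (h : ∀ z : Fin (r + r) × Fin n → ℂ,
      (star z ⬝ᵥ matPairing φ (offDiag v) *ᵥ z).re ≤ ‖WithLp.toLp 2 z‖ ^ 2) :
    ‖matPairing φ v‖ ≤ 1 := by
  refine Matrix.norm_le_of_two_re_le _ zero_le_one fun x y => ?_
  rw [← re_dotProduct_matPairing_offDiag hφ, ← norm_sq_blockVec, one_mul]
  exact h _

lemma blockVec_surjective (z : Fin (r + r) × Fin n → ℂ) :
    ∃ x y : Fin r × Fin n → ℂ, z = blockVec x y := by
  refine ⟨fun p => z (Fin.castAdd r p.1, p.2), fun p => z (Fin.natAdd r p.1, p.2), ?_⟩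
  ext ⟨k, i⟩
  refine Fin.addCases (fun k => ?_) (fun k => ?_) k <;> simp [blockVec, -Fin.natAdd_eq_addNat]

lemma one_lt_norm_matPairing_of_offDiag [StarAddMonoid V]
    {φ : V →ₗ[ℂ] Matrix (Fin n) (Fin n) ℂ}
    (hφ : ∀ v, φ (star v) = (φ v)ᴴ) (v : Matrix (Fin r) (Fin r) V)
    (z : Fin (r + r) × Fin n → ℂ)
    (h : ‖WithLp.toLp 2 z‖ ^ 2 < (star z ⬝ᵥ matPairing φ (offDiag v) *ᵥ z).re) :
    1 < ‖matPairing φ v‖ := by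
  obtain ⟨x, y, rfl⟩ := blockVec_surjective z
  rw [re_dotProduct_matPairing_offDiag hφ, norm_sq_blockVec] at h
  have := Matrix.two_re_dotProduct_mulVec_le (matPairing φ v) x y
  by_contra hc
  push Not at hc
  nlinarith [sq_nonneg ‖WithLp.toLp 2 x‖, sq_nonneg ‖WithLp.toLp 2 y‖]

/-- The map `v ↦ C* φ(v) C`. -/
def conjMap {m n : ℕ} (C : Matrix (Fin n) (Fin m) ℂ) (φ : V →ₗ[ℂ] Matrix (Fin n) (Fin n) ℂ) :
    V →ₗ[ℂ] Matrix (Fin m) (Fin m) ℂ where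
  toFun v := Cᴴ * φ v * C
  map_add' v w := by simp [Matrix.mul_add, Matrix.add_mul]
  map_smul' c v := by simp

lemma conjMap_apply {m n : ℕ} (C : Matrix (Fin n) (Fin m) ℂ)
    (φ : V →ₗ[ℂ] Matrix (Fin n) (Fin n) ℂ) (v : V) : conjMap C φ v = Cᴴ * φ v * C := rfl

lemma dotProduct_matPairing_conjMap {m n : ℕ} (C : Matrix (Fin n) (Fin m) ℂ)
    (φ : V →ₗ[ℂ] Matrix (Fin n) (Fin n) ℂ) (a : Matrix (Fin r) (Fin r) V)
    (x : Fin r × Fin m → ℂ) :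
    star x ⬝ᵥ matPairing (conjMap C φ) a *ᵥ x =
      star (fun p : Fin r × Fin n => (C *ᵥ fun j => x (p.1, j)) p.2) ⬝ᵥ
        matPairing φ a *ᵥ (fun p => (C *ᵥ fun j => x (p.1, j)) p.2) := by
  rw [dotProduct_matPairing_mulVec, dotProduct_matPairing_mulVec]
  refine Finset.sum_congr rfl fun k _ => Finset.sum_congr rfl fun l _ => ?_
  rw [conjMap_apply, ← Matrix.mulVec_mulVec, ← Matrix.mulVec_mulVec, Matrix.dotProduct_mulVec,
    ← Matrix.star_mulVec]

/-- The map `V → M_n` attached to a real functional `g` on `M_n(V)`: its entries are the values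
of the complex functional with real part `g` on the matrices with one nonzero entry. -/
noncomputable def toMap (g : Module.Dual ℝ (Matrix (Fin n) (Fin n) V)) :
    V →ₗ[ℂ] Matrix (Fin n) (Fin n) ℂ where
  toFun v := Matrix.of fun i j =>
    (Module.Dual.extendRCLike g : Module.Dual ℂ _) (Matrix.single i j v)
  map_add' v w := by
    ext i j
    simp only [Matrix.of_apply, Matrix.add_apply, Matrix.single_add, map_add]
  map_smul' c v := by
    ext i j
    simp only [Matrix.of_apply, Matrix.smul_apply, ← Matrix.smul_single, map_smul,
      RingHom.id_apply]

lemma re_dotProduct_matPairing_toMap (g : Module.Dual ℝ (Matrix (Fin n) (Fin n) V))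
    (a : Matrix (Fin r) (Fin r) V) (x : Fin r × Fin n → ℂ) :
    (star x ⬝ᵥ matPairing (toMap g) a *ᵥ x).re =
      g (matAct (Matrix.of fun k i => x (k, i))ᴴ a (Matrix.of fun k i => x (k, i))) := by
  set G : Module.Dual ℂ (Matrix (Fin n) (Fin n) V) := Module.Dual.extendRCLike g with hG
  have h : star x ⬝ᵥ matPairing (toMap g) a *ᵥ x =
      G (matAct (Matrix.of fun k i => x (k, i))ᴴ a (Matrix.of fun k i => x (k, i))) := by
    rw [dotProduct_matPairing_mulVec, Matrix.matrix_eq_sum_single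
      (matAct (Matrix.of fun k i => x (k, i))ᴴ a (Matrix.of fun k i => x (k, i)))]
    have h1 : ∀ (i j : Fin n) (v : V), G (Matrix.single i j v) = toMap g v i j :=
      fun i j v => rfl
    simp only [map_sum, h1, matAct, Matrix.of_apply, map_smul,
      dotProduct, Matrix.mulVec, Finset.mul_sum, Matrix.sum_apply, Matrix.smul_apply, smul_eq_mul,
      Matrix.conjTranspose_apply, Pi.star_apply]
    have h2 : ∀ F : Fin r → Fin r → Fin n → Fin n → ℂ,
        ∑ k, ∑ l, ∑ i, ∑ j, F k l i j = ∑ i, ∑ j, ∑ k, ∑ l, F k l i j := by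
      intro F
      calc ∑ k, ∑ l, ∑ i, ∑ j, F k l i j = ∑ k, ∑ i, ∑ l, ∑ j, F k l i j :=
            Finset.sum_congr rfl fun k _ => Finset.sum_comm
        _ = ∑ i, ∑ k, ∑ l, ∑ j, F k l i j := Finset.sum_comm
        _ = ∑ i, ∑ k, ∑ j, ∑ l, F k l i j :=
            Finset.sum_congr rfl fun i _ => Finset.sum_congr rfl fun k _ => Finset.sum_comm
        _ = _ := Finset.sum_congr rfl fun i _ => Finset.sum_comm
    rw [h2]
    refine Finset.sum_congr rfl fun i _ => Finset.sum_congr rfl fun j _ =>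
      Finset.sum_congr rfl fun k _ => Finset.sum_congr rfl fun l _ => ?_
    ring
  rw [h, hG]
  exact Module.Dual.re_extendRCLike_apply (𝕜 := ℂ) g _

lemma toMap_star [StarAddMonoid V] [StarModule ℂ V]
    {g : Module.Dual ℝ (Matrix (Fin n) (Fin n) V)} (hg : ∀ w, g wᴴ = g w) (v : V) :
    toMap g (star v) = (toMap g v)ᴴ := by
  have h1 : ∀ (i j : Fin n) (v : V), (Module.Dual.extendRCLike g : Module.Dual ℂ _)
      (Matrix.single i j v) = toMap g v i j := fun i j v => rfl
  ext i j
  rw [Matrix.conjTranspose_apply, ← h1, ← h1, Module.Dual.extendRCLike_apply,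
    Module.Dual.extendRCLike_apply, ← hg (Matrix.single i j (star v)),
    ← hg (_ • Matrix.single i j (star v))]
  have h2 : (Matrix.single i j (star v))ᴴ = Matrix.single j i v := by
    rw [Matrix.conjTranspose_single, star_star]
  rw [Matrix.conjTranspose_smul, h2]
  simp

end matPairing

/-! ### The matrix order unit -/

namespace MatrixOrderUnitSpace

variable {V : Type*} [AddCommGroup V] [Module ℂ V] [StarAddMonoid V] [StarModule ℂ V]
  (S : MatrixOrderUnitSpace V) {m n r : ℕ}

/-- The matrix unit `1_n` of `M_n(V)`. -/
def unit (n : ℕ) : Matrix (Fin n) (Fin n) V := Matrix.diagonal fun _ => S.one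

/-- The scalar matrix `c`, regarded as the element `c ⊗ 1` of `M_n(V)`. -/
def scal (c : Matrix (Fin n) (Fin n) ℂ) : Matrix (Fin n) (Fin n) V := c.map fun z => z • S.one

lemma star_one : star S.one = S.one :=
  congrFun (congrFun (S.isHermitian_of_mem 1 _ S.one_pos) 0) 0

lemma scal_one : S.scal (1 : Matrix (Fin n) (Fin n) ℂ) = S.unit n := by
  ext i j
  by_cases h : i = j <;> simp [scal, unit, h]

lemma scal_sub (c d : Matrix (Fin n) (Fin n) ℂ) : S.scal (c - d) = S.scal c - S.scal d := by
  ext i j; simp [scal, sub_smul]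

lemma scal_smul (t : ℝ) (c : Matrix (Fin n) (Fin n) ℂ) :
    S.scal ((t : ℂ) • c) = t • S.scal c := by
  ext i j; simp [scal, mul_smul]

lemma isHermitian_unit : (S.unit n).IsHermitian := by
  rw [unit, Matrix.IsHermitian, Matrix.diagonal_conjTranspose]
  congr 1
  ext
  exact S.star_one

/-- Positive scalar matrices are sums of matrices `γ* 1 γ` with rows `γ`. -/
lemma scal_mem {c : Matrix (Fin n) (Fin n) ℂ} (hc : c.PosSemidef) : S.scal c ∈ S.pos n := by
  open scoped MatrixOrder in
  obtain ⟨B, rfl⟩ := CStarAlgebra.nonneg_iff_eq_star_mul_self.mp hc.nonneg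
  have : S.scal (star B * B) = ∑ k, matAct (Matrix.of fun _ : Fin 1 => B k)ᴴ
      (Matrix.of fun _ _ => S.one) (Matrix.of fun _ : Fin 1 => B k) := by
    ext i j
    simp [scal, matAct, Matrix.mul_apply, Finset.sum_smul, Matrix.sum_apply, Matrix.star_apply]
  rw [this]
  exact Submodule.sum_mem _ fun k _ => S.conj_mem 1 n _ _ S.one_pos

lemma unit_mem : S.unit n ∈ S.pos n := S.scal_one (n := n) ▸ S.scal_mem Matrix.PosSemidef.one

lemma smul_mem_pos {v : Matrix (Fin n) (Fin n) V} (hv : v ∈ S.pos n) {t : ℝ} (ht : 0 ≤ t) :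
    t • v ∈ S.pos n := (S.pos n).smul_mem ht hv

/-- `γ* a γ` is bounded below by a multiple of `1_n`: compress `s 1 + a ≥ 0` and use
`γ* γ ≤ ‖γ‖²`. -/
lemma exists_add_row_mem {a : V} (ha : star a = a) (γ : Matrix (Fin 1) (Fin n) ℂ) :
    ∃ t : ℝ, 0 ≤ t ∧ t • S.unit n + matAct γᴴ (Matrix.of fun _ _ => a) γ ∈ S.pos n := by
  obtain ⟨t, ht, h⟩ := S.order_unit (-a) (by rw [star_neg, ha])
  refine ⟨t * (‖γ‖ * ‖γ‖), by positivity, ?_⟩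
  have h1 := S.conj_mem 1 n γ _ h
  have h2 := S.smul_mem_pos (S.scal_mem (Matrix.posSemidef_smul_one_sub
    (Matrix.isHermitian_conjTranspose_mul_self γ)
    (Matrix.l2_opNorm_conjTranspose_mul_self γ).le)) ht.le
  convert add_mem h2 h1 using 1
  rw [scal_sub, scal_smul, scal_one]
  ext i j
  simp only [Matrix.add_apply, Matrix.smul_apply, Matrix.sub_apply, matAct, Matrix.of_apply, scal,
    Matrix.map_apply, Matrix.mul_apply, Finset.univ_unique, Finset.sum_singleton, sub_neg_eq_add,
    smul_add, smul_sub, mul_smul, smul_comm _ t S.one]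
  abel

/-- The matrices `v` with `-t 1_n ≤ v` for some real `t`. -/
def BddBelowByUnit (v : Matrix (Fin n) (Fin n) V) : Prop :=
  ∃ t : ℝ, 0 ≤ t ∧ t • S.unit n + v ∈ S.pos n

variable {S}

lemma BddBelowByUnit.add {v w : Matrix (Fin n) (Fin n) V} (hv : S.BddBelowByUnit v)
    (hw : S.BddBelowByUnit w) : S.BddBelowByUnit (v + w) := by
  obtain ⟨t, ht, h⟩ := hv
  obtain ⟨s, hs, h'⟩ := hw
  refine ⟨t + s, add_nonneg ht hs, ?_⟩
  convert add_mem h h' using 1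
  module

variable (S)

omit [StarAddMonoid V] [StarModule ℂ V] in
lemma single_apply_eq_smul (i j k l : Fin n) (a : V) :
    Matrix.single i j a k l =
      ((if i = k then (1 : ℂ) else 0) * (if j = l then (1 : ℂ) else 0)) • a := by
  by_cases h : i = k <;> by_cases h' : j = l <;> simp [h, h']

lemma bddBelowByUnit_single_diag {a : V} (ha : star a = a) (i : Fin n) :
    S.BddBelowByUnit (Matrix.single i i a) := by
  have h : Matrix.single i i a = matAct (Matrix.of fun _ : Fin 1 => (Pi.single i 1 : Fin n → ℂ))ᴴ
      (Matrix.of fun _ _ => a) (Matrix.of fun _ : Fin 1 => (Pi.single i 1 : Fin n → ℂ)) := by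
    ext k l
    simp [matAct, single_apply_eq_smul, Pi.single_apply, @eq_comm _ i]
  rw [h]
  exact S.exists_add_row_mem ha _

lemma bddBelowByUnit_single_add {a : V} (ha : star a = a) (i j : Fin n) {ω : ℂ}
    (hω : ω * star ω = 1) :
    S.BddBelowByUnit (Matrix.single i j (ω • a) + Matrix.single j i (star ω • a)) := by
  have ha' : star (-a) = -a := by rw [star_neg, ha]
  -- the row `γ = ω̄ eᵢ + eⱼ` satisfies `γ* a γ = ω eᵢ a eⱼ* + ω̄ eⱼ a eᵢ* + eᵢ a eᵢ* + eⱼ a eⱼ*`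
  convert BddBelowByUnit.add (S.exists_add_row_mem ha (Matrix.of fun _ : Fin 1 =>
    (fun l => star ω * (if i = l then (1 : ℂ) else 0) + if j = l then (1 : ℂ) else 0)))
    ((S.bddBelowByUnit_single_diag ha' i).add (S.bddBelowByUnit_single_diag ha' j)) using 1
  ext k l
  have hc : ∀ i : Fin n, star (if i = k then (1 : ℂ) else 0) = if i = k then (1 : ℂ) else 0 := by
    intro i
    split_ifs <;> simp
  simp only [matAct, single_apply_eq_smul, Matrix.of_apply, Finset.univ_unique,
    Finset.sum_singleton, Matrix.conjTranspose_apply, Matrix.add_apply, star_add, star_mul',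
    star_star, hc]
  match_scalars
  linear_combination (-(if i = k then (1 : ℂ) else 0) * (if i = l then (1 : ℂ) else 0)) * hω

/-- The matrix unit is an order unit of every `M_n(V)`, by polarization. -/
lemma bddBelowByUnit_add_conjTranspose (v : Matrix (Fin n) (Fin n) V) :
    S.BddBelowByUnit (v + vᴴ) := by
  have h0 : S.BddBelowByUnit (0 : Matrix (Fin n) (Fin n) V) :=
    ⟨0, le_rfl, by simp⟩
  have h : v + vᴴ = ∑ i, ∑ j, (Matrix.single i j (v i j) + Matrix.single j i (star (v i j))) := by
    conv_lhs => rw [Matrix.matrix_eq_sum_single v]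
    simp only [Matrix.conjTranspose_sum, Matrix.conjTranspose_single, Finset.sum_add_distrib]
  rw [h]
  refine Finset.sum_induction _ S.BddBelowByUnit (fun _ _ => .add) h0 fun i _ =>
    Finset.sum_induction _ S.BddBelowByUnit (fun _ _ => .add) h0 fun j _ => ?_
  obtain ⟨x, y, hx, hy, hv⟩ : ∃ x y : V, star x = x ∧ star y = y ∧ v i j = x + Complex.I • y :=
    ⟨realPart (v i j), imaginaryPart (v i j), (realPart (v i j)).2, (imaginaryPart (v i j)).2,
      (realPart_add_I_smul_imaginaryPart (v i j)).symm⟩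
  convert (S.bddBelowByUnit_single_add hx i j (ω := 1) (by simp)).add
    (S.bddBelowByUnit_single_add hy i j (ω := Complex.I) (by simp)) using 1
  rw [hv, star_add, star_smul, hx, hy]
  simp only [Matrix.single_add, one_smul, _root_.star_one]
  abel

lemma exists_smul_unit_add_mem (v : Matrix (Fin n) (Fin n) V) :
    ∃ t₀ : ℝ, ∀ t, t₀ ≤ t → (t • S.unit n + v) + (t • S.unit n + v)ᴴ ∈ S.pos n := by
  obtain ⟨s, hs, h⟩ := S.bddBelowByUnit_add_conjTranspose v
  refine ⟨s, fun t ht => ?_⟩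
  have hs2 := S.smul_mem_pos (S.unit_mem (n := n)) (t := 2 * t - s) (by linarith)
  convert add_mem hs2 h using 1
  rw [Matrix.conjTranspose_add, Matrix.conjTranspose_smul, S.isHermitian_unit.eq]
  simp only [star_trivial]
  module

/-! ### The matrix norm -/

lemma blockMat_smul_unit (t : ℝ) (v : Matrix (Fin n) (Fin n) V) :
    blockMat (t • S.unit n) v vᴴ (t • S.unit n) = t • S.unit (n + n) + offDiag v := by
  apply ext_blocks <;> intro i j <;>
    simp [unit, offDiag, Matrix.diagonal_apply, -Fin.natAdd_eq_addNat] <;>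
    exact fun h => absurd (congrArg Fin.val h) (by simp; omega)

lemma exists_blockMat_mem (v : Matrix (Fin n) (Fin n) V) :
    ∃ t : ℝ, 0 ≤ t ∧ blockMat (t • S.unit n) v vᴴ (t • S.unit n) ∈ S.pos (n + n) := by
  obtain ⟨t, ht, h⟩ := S.bddBelowByUnit_add_conjTranspose (blockMat 0 v 0 0)
  refine ⟨t, ht, ?_⟩
  rw [blockMat_smul_unit]
  convert h using 2
  rw [conjTranspose_blockMat]
  apply ext_blocks <;> intro i j <;> simp [offDiag, -Fin.natAdd_eq_addNat]

/-- A self-adjoint matrix between `-δ 1_n` and `δ 1_n` has norm at most `δ`. -/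
lemma matNorm_le_of_mem {x : Matrix (Fin n) (Fin n) V} (hx : x.IsHermitian) {δ : ℝ} (hδ : 0 ≤ δ)
    (h₁ : δ • S.unit n + x ∈ S.pos n) (h₂ : δ • S.unit n - x ∈ S.pos n) : S.matNorm x ≤ δ := by
  have hmem : blockMat (δ • S.unit n) x xᴴ (δ • S.unit n) ∈ S.pos (n + n) := by
    -- conjugate the two inequalities by the rows `[1, 1]` and `[1, -1]`
    have h3 := S.smul_mem_pos (add_mem
      (S.conj_mem n (n + n) (stack 1 1)ᴴ _ h₁) (S.conj_mem n (n + n) (stack 1 (-1))ᴴ _ h₂))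
      (show (0 : ℝ) ≤ 1 / 2 by norm_num)
    convert h3 using 1
    rw [hx.eq]
    generalize hp : δ • S.unit n + x = p
    generalize hq : δ • S.unit n - x = q
    have h4 : δ • S.unit n = (1 / 2 : ℝ) • (p + q) := by rw [← hp, ← hq]; module
    have h5 : x = (1 / 2 : ℝ) • (p - q) := by rw [← hp, ← hq]; module
    rw [h4, h5]
    apply ext_blocks <;> intro i j <;>
      simp [matAct, stack, Matrix.one_apply, ite_smul, Matrix.conjTranspose_apply,
        -Fin.natAdd_eq_addNat] <;> module
  rw [matNorm]
  by_cases hb : BddBelow {t : ℝ | blockMat (t • Matrix.diagonal fun _ => S.one) x xᴴ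
    (t • Matrix.diagonal fun _ => S.one) ∈ S.pos (n + n)}
  · exact csInf_le hb hmem
  · rw [Real.sInf_of_not_bddBelow hb]
    exact hδ

/-! ### Completely positive maps -/

variable {S}

/-- Completely positive maps preserve the involution. -/
lemma IsCompletelyPositive.map_star {φ : V →ₗ[ℂ] Matrix (Fin n) (Fin n) ℂ}
    (hφ : S.IsCompletelyPositive φ) (v : V) : φ (star v) = (φ v)ᴴ := by
  have h1 : ∀ a : V, (Matrix.of fun _ _ : Fin 1 => a) ∈ S.pos 1 → (φ a)ᴴ = φ a := by
    intro a ha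
    have h := (hφ 1 _ ha).isHermitian
    ext i j
    exact congrFun (congrFun h (0, i)) (0, j)
  have h2 : ∀ a : V, star a = a → (φ a)ᴴ = φ a := by
    intro a ha
    obtain ⟨t, ht, h⟩ := S.order_unit a ha
    have h3 := h1 _ h
    have h4 := h1 _ S.one_pos
    rw [map_sub, LinearMap.map_smul_of_tower, Matrix.conjTranspose_sub,
      Matrix.conjTranspose_smul, h4, star_trivial] at h3
    exact sub_right_injective h3
  have h3 := realPart_add_I_smul_imaginaryPart v
  have hre := h2 _ (realPart v).2
  have him := h2 _ (imaginaryPart v).2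
  have h4 : star v = (realPart v : V) + star Complex.I • (imaginaryPart v : V) := by
    conv_lhs => rw [← h3]
    rw [star_add, star_smul]
    congr 1
    · exact (realPart v).2
    · congr 1
      exact (imaginaryPart v).2
  rw [h4]
  conv_rhs => rw [← h3]
  rw [map_add, map_add, map_smul, map_smul, Matrix.conjTranspose_add, Matrix.conjTranspose_smul,
    hre, him]

lemma matPairing_smul_unit (φ : V →ₗ[ℂ] Matrix (Fin n) (Fin n) ℂ) {c : ℝ}
    (h1 : φ S.one = (c : ℂ) • (1 : Matrix (Fin n) (Fin n) ℂ)) (t : ℝ) :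
    matPairing φ (t • S.unit r) =
      ((t * c : ℝ) : ℂ) • (1 : Matrix (Fin r × Fin n) (Fin r × Fin n) ℂ) := by
  ext ⟨k, i⟩ ⟨l, j⟩
  by_cases h : k = l
  · subst h
    simp [matPairing, unit, h1, Matrix.one_apply]
  · simp [matPairing, unit, h]

lemma IsCompletelyPositive.two_re_le {φ : V →ₗ[ℂ] Matrix (Fin n) (Fin n) ℂ}
    (hφ : S.IsCompletelyPositive φ) {c : ℝ}
    (h1 : φ S.one = (c : ℂ) • (1 : Matrix (Fin n) (Fin n) ℂ)) {v : Matrix (Fin r) (Fin r) V}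
    {t : ℝ} (h : blockMat (t • S.unit r) v vᴴ (t • S.unit r) ∈ S.pos (r + r))
    (x y : Fin r × Fin n → ℂ) :
    2 * (star x ⬝ᵥ matPairing φ v *ᵥ y).re ≤
      t * c * (‖WithLp.toLp 2 x‖ ^ 2 + ‖WithLp.toLp 2 y‖ ^ 2) := by
  have h2 := (hφ _ _ h).re_nonneg (blockVec (-x) y)
  rw [dotProduct_matPairing_blockMat, matPairing_smul_unit φ h1,
    matPairing_conjTranspose hφ.map_star] at h2
  simp only [Complex.add_re, re_dotProduct_conjTranspose, Matrix.smul_mulVec, Matrix.one_mulVec,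
    dotProduct_smul, smul_eq_mul, Complex.re_ofReal_mul, Matrix.re_star_dotProduct_self, star_neg,
    neg_dotProduct, dotProduct_neg, Matrix.mulVec_neg, Complex.neg_re] at h2
  linarith

lemma IsCompletelyPositive.norm_matPairing_le {φ : V →ₗ[ℂ] Matrix (Fin n) (Fin n) ℂ}
    (hφ : S.IsCompletelyPositive φ) {c : ℝ} (hc : 0 ≤ c)
    (h1 : φ S.one = (c : ℂ) • (1 : Matrix (Fin n) (Fin n) ℂ)) {v : Matrix (Fin r) (Fin r) V}
    {t : ℝ} (ht : 0 ≤ t) (h : blockMat (t • S.unit r) v vᴴ (t • S.unit r) ∈ S.pos (r + r)) :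
    ‖matPairing φ v‖ ≤ t * c :=
  Matrix.norm_le_of_two_re_le _ (mul_nonneg ht hc) fun x y => hφ.two_re_le h1 h x y

/-- A completely positive map that vanishes at the unit is zero. -/
lemma IsCompletelyPositive.matPairing_eq_zero {φ : V →ₗ[ℂ] Matrix (Fin n) (Fin n) ℂ}
    (hφ : S.IsCompletelyPositive φ) (h1 : φ S.one = 0) (v : Matrix (Fin r) (Fin r) V) :
    matPairing φ v = 0 := by
  obtain ⟨t, ht, h⟩ := S.exists_blockMat_mem v
  have := hφ.norm_matPairing_le (c := 0) le_rfl (by simpa using h1) ht h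
  rw [mul_zero] at this
  exact norm_le_zero_iff.1 this

/-- Unital completely positive maps are completely contractive. -/
lemma IsCompletelyPositive.isCompletelyBounded {φ : V →ₗ[ℂ] Matrix (Fin n) (Fin n) ℂ}
    (hφ : S.IsCompletelyPositive φ) (hn : 0 < n) (h1 : φ S.one = 1) :
    S.IsCompletelyBounded φ := by
  have h1' : φ S.one = ((1 : ℝ) : ℂ) • (1 : Matrix (Fin n) (Fin n) ℂ) := by simpa using h1
  refine ⟨1, fun r a => ?_⟩
  rw [one_mul]
  rcases Nat.eq_zero_or_pos r with rfl | hr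
  · -- in size `0` the infimum runs over all real numbers, and its value is `0`
    have h0 : S.matNorm a = 0 := by
      rw [matNorm]
      convert Real.sInf_univ
      refine Set.eq_univ_of_forall fun t => ?_
      have : ∀ w : Matrix (Fin (0 + 0)) (Fin (0 + 0)) V, w ∈ S.pos (0 + 0) := fun w => by
        have hw : w = 0 := by
          ext i
          exact (show Fin 0 from i).elim0
        exact hw ▸ zero_mem _
      exact this _
    have h2 : matPairing φ a = 0 := by
      ext ⟨k, i⟩
      exact k.elim0
    rw [h0, h2, norm_zero]
  · obtain ⟨t₀, -, ht₀⟩ := S.exists_blockMat_mem a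
    refine le_csInf ⟨t₀, ht₀⟩ fun t ht => ?_
    have htnn : 0 ≤ t := by
      have h2 := hφ.two_re_le h1' ht (Pi.single (⟨0, hr⟩, ⟨0, hn⟩) 1) 0
      simpa using h2
    simpa using hφ.norm_matPairing_le zero_le_one h1' htnn ht

end MatrixOrderUnitSpace

/-! ### Matrix Lipschitz seminorms -/

namespace MatrixLipschitzSeminorm

variable {V : Type*} [AddCommGroup V] [Module ℂ V] [StarAddMonoid V] [StarModule ℂ V]
  {S : MatrixOrderUnitSpace V} (𝓛 : MatrixLipschitzSeminorm S) {m n r : ℕ}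

lemma L_compression_le (v : Matrix (Fin m) (Fin m) V) (γ : Matrix (Fin m) (Fin n) ℂ) :
    𝓛.L n (matAct γᴴ v γ) ≤ ‖γ‖ * ‖γ‖ * 𝓛.L m v := by
  refine (𝓛.map_matAct_le m n γᴴ v γ).trans (le_of_eq ?_)
  rw [Matrix.l2_opNorm_conjTranspose]
  ring

/-- The swap `[[0, 1], [1, 0]]` turns `v ⊕ v*` into `[[0, v], [v*, 0]]` and back. -/
lemma L_offDiag (v : Matrix (Fin n) (Fin n) V) : 𝓛.L (n + n) (offDiag v) = 𝓛.L n v := by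
  have hs : 𝓛.L (n + n) (matDirectSum v vᴴ) = 𝓛.L n v := by
    rw [𝓛.map_directSum, 𝓛.map_conjTranspose, max_self]
  have key : ∀ w : Matrix (Fin (n + n)) (Fin (n + n)) V,
      𝓛.L (n + n) (matAct 1 w (swapMat n)) ≤ 𝓛.L (n + n) w := by
    intro w
    refine (𝓛.map_matAct_le _ _ 1 w (swapMat n)).trans ?_
    have h0 := apply_nonneg (𝓛.L (n + n)) w
    calc ‖(1 : Matrix (Fin (n + n)) (Fin (n + n)) ℂ)‖ * 𝓛.L (n + n) w * ‖swapMat n‖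
        ≤ 1 * 𝓛.L (n + n) w * 1 := by
          gcongr
          exacts [norm_one_matrix_le _, norm_swapMat_le n]
      _ = _ := by ring
  apply le_antisymm
  · rw [← matAct_one_swapMat, ← hs]
    exact key _
  · rw [← hs, ← matAct_one_offDiag_swapMat]
    exact key _

end MatrixLipschitzSeminorm

/-! ### Accretive elements -/

namespace MatrixOrderUnitSpace

variable {V : Type*} [AddCommGroup V] [Module ℂ V] [StarAddMonoid V] [StarModule ℂ V]
  (S : MatrixOrderUnitSpace V)

/-- The cone of accretive elements of `M_n(V)`: those with positive real part. Positive functionals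
on the self-adjoint part of `M_n(V)` correspond to real functionals on `M_n(V)` that are nonnegative
on this cone. -/
def accretive (n : ℕ) : PointedCone ℝ (Matrix (Fin n) (Fin n) V) where
  carrier := {v | v + vᴴ ∈ S.pos n}
  add_mem' {v w} hv hw := by
    have := add_mem (show v + vᴴ ∈ S.pos n from hv) (show w + wᴴ ∈ S.pos n from hw)
    show v + w + (v + w)ᴴ ∈ S.pos n
    rw [Matrix.conjTranspose_add]
    convert this using 1
    abel
  zero_mem' := by simp
  smul_mem' c v hv := by
    have := S.smul_mem_pos (show v + vᴴ ∈ S.pos n from hv) c.2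
    show (c : ℝ) • v + ((c : ℝ) • v)ᴴ ∈ S.pos n
    rw [Matrix.conjTranspose_smul, star_trivial, ← smul_add]
    exact this

lemma mem_accretive {n : ℕ} {v : Matrix (Fin n) (Fin n) V} :
    v ∈ S.accretive n ↔ v + vᴴ ∈ S.pos n := Iff.rfl

lemma pos_le_accretive {n : ℕ} {v : Matrix (Fin n) (Fin n) V} (hv : v ∈ S.pos n) :
    v ∈ S.accretive n := by
  rw [mem_accretive, (S.isHermitian_of_mem n v hv).eq]
  exact add_mem hv hv

lemma sub_conjTranspose_mem_accretive {n : ℕ} (v : Matrix (Fin n) (Fin n) V) :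
    v - vᴴ ∈ S.accretive n := by
  rw [mem_accretive]
  simp

lemma smul_mem_accretive {n : ℕ} {v : Matrix (Fin n) (Fin n) V} (hv : v ∈ S.accretive n) {t : ℝ}
    (ht : 0 ≤ t) : t • v ∈ S.accretive n := (S.accretive n).smul_mem ht hv

end MatrixOrderUnitSpace

/-- The cone of accretive scalar matrices. -/
def accretiveMat (n : ℕ) : PointedCone ℝ (Matrix (Fin n) (Fin n) ℂ) where
  carrier := {h | (h + hᴴ).PosSemidef}
  add_mem' {v w} hv hw := by
    have := (show (v + vᴴ).PosSemidef from hv).add (show (w + wᴴ).PosSemidef from hw)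
    show (v + w + (v + w)ᴴ).PosSemidef
    rw [Matrix.conjTranspose_add]
    convert this using 1
    abel
  zero_mem' := by simp [Matrix.PosSemidef.zero]
  smul_mem' c v hv := by
    have := (show (v + vᴴ).PosSemidef from hv).smul c.2
    show ((c : ℝ) • v + ((c : ℝ) • v)ᴴ).PosSemidef
    rw [Matrix.conjTranspose_smul, star_trivial, ← smul_add]
    exact this

lemma mem_accretiveMat {n : ℕ} {h : Matrix (Fin n) (Fin n) ℂ} :
    h ∈ accretiveMat n ↔ (h + hᴴ).PosSemidef := Iff.rfl

lemma posSemidef_mem_accretiveMat {n : ℕ} {h : Matrix (Fin n) (Fin n) ℂ} (hh : h.PosSemidef) :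
    h ∈ accretiveMat n := by
  rw [mem_accretiveMat, hh.isHermitian.eq]
  exact hh.add hh

lemma exists_smul_one_add_mem_accretiveMat {n : ℕ} (h : Matrix (Fin n) (Fin n) ℂ) :
    ∃ t₀ : ℝ, ∀ t, t₀ ≤ t → t • (1 : Matrix (Fin n) (Fin n) ℂ) + h ∈ accretiveMat n := by
  refine ⟨‖-(h + hᴴ)‖, fun t ht => ?_⟩
  have h1 : (-(h + hᴴ)).IsHermitian := by
    rw [Matrix.IsHermitian, Matrix.conjTranspose_neg, Matrix.conjTranspose_add,
      Matrix.conjTranspose_conjTranspose, add_comm]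
  have h2 := Matrix.posSemidef_smul_one_sub h1 (c := 2 * t) (by linarith [norm_nonneg (-(h + hᴴ))])
  rw [mem_accretiveMat]
  convert h2 using 1
  rw [Matrix.conjTranspose_add, Matrix.conjTranspose_smul, Matrix.conjTranspose_one, star_trivial]
  ext i j
  simp only [Matrix.add_apply, Matrix.smul_apply, Matrix.sub_apply, Matrix.neg_apply,
    Complex.real_smul, smul_eq_mul]
  push_cast
  ring

/-! ### Separation from the unit ball of a matrix Lipschitz seminorm -/

namespace MatrixLipschitzSeminorm

variable {V : Type*} [AddCommGroup V] [Module ℂ V] [StarAddMonoid V] [StarModule ℂ V]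
  {S : MatrixOrderUnitSpace V} (𝓛 : MatrixLipschitzSeminorm S) {m n r : ℕ}

/-- Lower semicontinuity, expressed with the matrix order: near a self-adjoint `a` with `L(a) > 1`
there is no `w` with `L(w)` close to `1`. -/
lemma exists_forall_one_add_lt (h𝓛 : 𝓛.IsLowerSemicontinuous) {a : Matrix (Fin n) (Fin n) V}
    (ha : a.IsHermitian) (h1 : 1 < 𝓛.L n a) :
    ∃ ε : ℝ, 0 < ε ∧ ∀ w, ε • S.unit n + (w - a) ∈ S.accretive n →
      ε • S.unit n - (w - a) ∈ S.accretive n → 1 + ε < 𝓛.L n w := by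
  obtain ⟨y, hy1, hy2⟩ := exists_between h1
  let := S.normTopology n
  obtain ⟨ε₀, hε₀, h⟩ : ∃ ε : ℝ, 0 < ε ∧ ∀ b, S.matNorm (b - a) < ε → y < 𝓛.L n b :=
    (h𝓛 n).isOpen_preimage y a hy2
  refine ⟨min (ε₀ / 2) (y - 1), lt_min (by linarith) (by linarith), fun w hw1 hw2 => ?_⟩
  set ε := min (ε₀ / 2) (y - 1) with hε
  have hεpos : 0 < ε := lt_min (by linarith) (by linarith)
  have hε1 : ε ≤ ε₀ / 2 := min_le_left _ _
  have hε2 : ε ≤ y - 1 := min_le_right _ _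
  set w' := (1 / 2 : ℝ) • (w + wᴴ) with hw'
  have hw'h : w'ᴴ = w' := by
    rw [hw', Matrix.conjTranspose_smul, Matrix.conjTranspose_add,
      Matrix.conjTranspose_conjTranspose, star_trivial, add_comm]
  have hL : 𝓛.L n w' ≤ 𝓛.L n w := by
    have e : w' = (1 / 2 : ℂ) • (w + wᴴ) := by
      rw [hw']
      ext i j
      simp only [Matrix.smul_apply]
      rw [← Complex.coe_smul]
      norm_num
    rw [e, map_smul_eq_mul]
    have h2 := map_add_le_add (𝓛.L n) w wᴴ
    rw [𝓛.map_conjTranspose] at h2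
    norm_num
    linarith
  have hx : (w' - a).IsHermitian := by
    rw [Matrix.IsHermitian, Matrix.conjTranspose_sub, hw'h, ha.eq]
  have hN : S.matNorm (w' - a) ≤ ε := by
    refine S.matNorm_le_of_mem hx hεpos.le ?_ ?_
    · convert S.smul_mem_pos (S.mem_accretive.1 hw1) (t := 1 / 2) (by norm_num) using 1
      rw [Matrix.conjTranspose_add, Matrix.conjTranspose_smul, S.isHermitian_unit.eq,
        Matrix.conjTranspose_sub, ha.eq, star_trivial]
      module
    · convert S.smul_mem_pos (S.mem_accretive.1 hw2) (t := 1 / 2) (by norm_num) using 1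
      rw [Matrix.conjTranspose_sub, Matrix.conjTranspose_smul, S.isHermitian_unit.eq,
        Matrix.conjTranspose_sub, ha.eq, star_trivial]
      module
  have := h w' (by linarith)
  linarith

/-- The cone generated by the triples of accretive elements, by the triples `(-γ*vγ, γ*vγ, γ*γ)`
with `L(v) ≤ 1`, and by `-y`. Functionals that are nonnegative on it are triples `(f₁, f₂, p)` of
positive functionals such that `f₁ - f₂` is dominated by `p` on the matrix unit ball of `L`, and
whose value at `y` is not positive. -/
def separationCone (n : ℕ)
    (y : Matrix (Fin n) (Fin n) V × Matrix (Fin n) (Fin n) V × Matrix (Fin n) (Fin n) ℂ) :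
    PointedCone ℝ
      (Matrix (Fin n) (Fin n) V × Matrix (Fin n) (Fin n) V × Matrix (Fin n) (Fin n) ℂ) where
  carrier := {x | ∃ (t : ℝ) (r : ℕ) (v : Matrix (Fin r) (Fin r) V) (γ : Matrix (Fin r) (Fin n) ℂ),
    0 ≤ t ∧ 𝓛.L r v ≤ 1 ∧ x.1 + matAct γᴴ v γ + t • y.1 ∈ S.accretive n ∧
      x.2.1 - matAct γᴴ v γ + t • y.2.1 ∈ S.accretive n ∧
      x.2.2 - γᴴ * γ + t • y.2.2 ∈ accretiveMat n}
  add_mem' := by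
    rintro x x' ⟨t, r, v, γ, ht, hv, h1, h2, h3⟩ ⟨t', r', v', γ', ht', hv', h1', h2', h3'⟩
    refine ⟨t + t', r + r', matDirectSum v v', stack γ γ', add_nonneg ht ht', ?_, ?_, ?_, ?_⟩
    · rw [𝓛.map_directSum]
      exact max_le hv hv'
    · rw [matAct_matDirectSum]
      convert add_mem h1 h1' using 1
      simp only [Prod.fst_add]
      module
    · rw [matAct_matDirectSum]
      convert add_mem h2 h2' using 1
      simp only [Prod.fst_add, Prod.snd_add]
      module
    · rw [conjTranspose_stack_mul_stack]
      convert add_mem h3 h3' using 1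
      simp only [Prod.snd_add]
      module
  zero_mem' := ⟨0, n, 0, 0, le_rfl, by simp, by simp [matAct_zero], by simp [matAct_zero], by simp⟩
  smul_mem' := by
    rintro ⟨c, hc⟩ x ⟨t, r, v, γ, ht, hv, h1, h2, h3⟩
    have hsq : star ((√c : ℝ) : ℂ) * ((√c : ℝ) : ℂ) = ((c : ℝ) : ℂ) := by
      rw [Complex.star_def, Complex.conj_ofReal, ← Complex.ofReal_mul, Real.mul_self_sqrt hc]
    have hγ : matAct (((√c : ℝ) : ℂ) • γ)ᴴ v (((√c : ℝ) : ℂ) • γ) = c • matAct γᴴ v γ := by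
      rw [Matrix.conjTranspose_smul, smul_matAct_smul, hsq, Complex.coe_smul]
    have hγ' : (((√c : ℝ) : ℂ) • γ)ᴴ * (((√c : ℝ) : ℂ) • γ) = c • (γᴴ * γ) := by
      rw [Matrix.conjTranspose_smul, Matrix.smul_mul, Matrix.mul_smul, smul_smul, hsq,
        Complex.coe_smul]
    refine ⟨c * t, r, v, ((√c : ℝ) : ℂ) • γ, mul_nonneg hc ht, hv, ?_, ?_, ?_⟩
    · rw [hγ]
      convert S.smul_mem_accretive h1 hc using 1
      show c • x.1 + _ + _ = _
      module
    · rw [hγ]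
      convert S.smul_mem_accretive h2 hc using 1
      show c • x.2.1 - _ + _ = _
      module
    · rw [hγ']
      convert (accretiveMat n).smul_mem hc h3 using 1
      show c • x.2.2 - _ + _ = _
      module

/-- A self-adjoint `a` with `L(a) > 1` is separated from the matrix unit ball of `L` by a difference
of positive functionals `f₁ - f₂` on `M_n(V)`, dominated there by a positive functional `p` on
scalar matrices. -/
theorem exists_separating_functionals (h𝓛 : 𝓛.IsLowerSemicontinuous) (hn : 0 < n)
    {a : Matrix (Fin n) (Fin n) V} (ha : a.IsHermitian) (h1 : 1 < 𝓛.L n a) :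
    ∃ (f₁ f₂ : Module.Dual ℝ (Matrix (Fin n) (Fin n) V))
      (p : Module.Dual ℝ (Matrix (Fin n) (Fin n) ℂ)),
      (∀ x ∈ S.accretive n, 0 ≤ f₁ x) ∧ (∀ x ∈ S.accretive n, 0 ≤ f₂ x) ∧
      (∀ h ∈ accretiveMat n, 0 ≤ p h) ∧
      (∀ (r : ℕ) (v : Matrix (Fin r) (Fin r) V) (γ : Matrix (Fin r) (Fin n) ℂ), 𝓛.L r v ≤ 1 →
        f₁ (matAct γᴴ v γ) - f₂ (matAct γᴴ v γ) ≤ p (γᴴ * γ)) ∧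
      p 1 < f₁ a - f₂ a := by
  obtain ⟨ε, hε, hlsc⟩ := 𝓛.exists_forall_one_add_lt h𝓛 ha h1
  set u : Matrix (Fin n) (Fin n) V × Matrix (Fin n) (Fin n) V × Matrix (Fin n) (Fin n) ℂ :=
    (S.unit n, S.unit n, 1) with hu
  set y : Matrix (Fin n) (Fin n) V × Matrix (Fin n) (Fin n) V × Matrix (Fin n) (Fin n) ℂ :=
    (-a, a, 1) + ε • u with hy
  -- `-u` in the cone would give `w = γ*vγ / t` within `ε` of `a` with `L(w) ≤ 1 + ε`
  have hneg : -u ∉ 𝓛.separationCone n y := by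
    rintro ⟨t, r, v, γ, ht, hv, h1, h2, h3⟩
    replace h1 : -S.unit n + matAct γᴴ v γ + t • (-a + ε • S.unit n) ∈ S.accretive n := h1
    replace h2 : -S.unit n - matAct γᴴ v γ + t • (a + ε • S.unit n) ∈ S.accretive n := h2
    replace h3 : -1 - γᴴ * γ + t • ((1 : Matrix (Fin n) (Fin n) ℂ) + ε • 1) ∈ accretiveMat n := h3
    have h4 : (((t * (1 + ε) - 1 : ℝ) : ℂ) • (1 : Matrix (Fin n) (Fin n) ℂ) -
        γᴴ * γ).PosSemidef := by
      convert (mem_accretiveMat.1 h3).smul (show (0 : ℝ) ≤ 1 / 2 by norm_num) using 1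
      simp only [Matrix.conjTranspose_add, Matrix.conjTranspose_sub, Matrix.conjTranspose_smul,
        Matrix.conjTranspose_mul, Matrix.conjTranspose_conjTranspose, Matrix.conjTranspose_one,
        Matrix.conjTranspose_neg, star_trivial]
      ext i j
      simp only [Matrix.add_apply, Matrix.smul_apply, Matrix.sub_apply, Matrix.neg_apply,
        Complex.real_smul, smul_eq_mul]
      push_cast
      ring
    have h5 : 0 ≤ t * (1 + ε) - 1 := by
      have h6 := (h4.add (Matrix.posSemidef_conjTranspose_mul_self γ)).diag_nonneg (i := ⟨0, hn⟩)
      simp only [sub_add_cancel, Matrix.smul_apply, Matrix.one_apply_eq, smul_eq_mul, mul_one] at h6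
      exact_mod_cast h6
    have htpos : 0 < t := by
      rcases ht.eq_or_lt with rfl | h
      · linarith
      · exact h
    have h6 := Matrix.norm_sq_le_of_posSemidef h5 h4
    have h7 := hlsc (t⁻¹ • matAct γᴴ v γ) ?_ ?_
    · have h8 : 𝓛.L n (t⁻¹ • matAct γᴴ v γ) ≤ 1 + ε := by
        rw [← Complex.coe_smul, map_smul_eq_mul, Complex.norm_real,
          Real.norm_of_nonneg (inv_nonneg.2 ht)]
        have h9 : 𝓛.L n (matAct γᴴ v γ) ≤ t * (1 + ε) := by
          refine (𝓛.L_compression_le v γ).trans ?_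
          calc ‖γ‖ * ‖γ‖ * 𝓛.L r v ≤ ‖γ‖ * ‖γ‖ * 1 := by gcongr
            _ ≤ t * (1 + ε) := by linarith
        rw [inv_mul_le_iff₀ htpos]
        exact h9
      linarith
    · convert S.smul_mem_accretive (add_mem h1 (S.pos_le_accretive S.unit_mem))
        (inv_nonneg.2 ht) using 1
      have : t⁻¹ * t = 1 := inv_mul_cancel₀ htpos.ne'
      match_scalars <;> field_simp; ring
    · convert S.smul_mem_accretive (add_mem h2 (S.pos_le_accretive S.unit_mem))
        (inv_nonneg.2 ht) using 1
      match_scalars <;> field_simp; ring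
  have hmem1 : ∀ x ∈ S.accretive n, ∀ x' ∈ S.accretive n, ∀ h ∈ accretiveMat n,
      (x, x', h) ∈ 𝓛.separationCone n y := fun x hx x' hx' h hh =>
    ⟨0, n, 0, 0, le_rfl, by simp, by simpa [matAct_zero] using hx,
      by simpa [matAct_zero] using hx', by simpa using hh⟩
  have hu0 : u ≠ 0 := by
    intro h
    rw [h, neg_zero] at hneg
    exact hneg (zero_mem _)
  have hnonneg : ∀ x : (LinearPMap.mkSpanSingleton (σ := RingHom.id ℝ) u (1 : ℝ) hu0).domain,
      (x : Matrix (Fin n) (Fin n) V × Matrix (Fin n) (Fin n) V × Matrix (Fin n) (Fin n) ℂ) ∈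
        𝓛.separationCone n y →
      0 ≤ LinearPMap.mkSpanSingleton (σ := RingHom.id ℝ) u (1 : ℝ) hu0 x := by
    rintro ⟨x, hx⟩ hx'
    obtain ⟨c, rfl⟩ := Submodule.mem_span_singleton.1 hx
    have h2 : LinearPMap.mkSpanSingleton (σ := RingHom.id ℝ) u (1 : ℝ) hu0 ⟨c • u, hx⟩ = c := by
      have := LinearPMap.mkSpanSingleton'_apply (σ := RingHom.id ℝ) u (1 : ℝ)
        (fun c hc => by simpa [hu0] using hc) c hx
      simpa using this
    rw [h2]
    by_contra hc
    push Not at hc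
    apply hneg
    have h3 := (𝓛.separationCone n y).smul_mem (inv_nonneg.2 (neg_nonneg.2 hc.le)) hx'
    rw [smul_smul] at h3
    convert h3 using 1
    rw [inv_neg, neg_mul, inv_mul_cancel₀ hc.ne, neg_one_smul]
  have hdense : ∀ z, ∃ x : (LinearPMap.mkSpanSingleton (σ := RingHom.id ℝ) u (1 : ℝ) hu0).domain,
      (x : Matrix (Fin n) (Fin n) V × Matrix (Fin n) (Fin n) V × Matrix (Fin n) (Fin n) ℂ) + z ∈
        𝓛.separationCone n y := by
    intro z
    obtain ⟨t₁, ht₁⟩ := S.exists_smul_unit_add_mem z.1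
    obtain ⟨t₂, ht₂⟩ := S.exists_smul_unit_add_mem z.2.1
    obtain ⟨t₃, ht₃⟩ := exists_smul_one_add_mem_accretiveMat z.2.2
    set t := max t₁ (max t₂ t₃)
    refine ⟨⟨t • u, Submodule.mem_span_singleton.2 ⟨t, rfl⟩⟩, ?_⟩
    exact hmem1 _ (ht₁ t (le_max_left _ _)) _ (ht₂ t ((le_max_left _ _).trans (le_max_right _ _))) _
      (ht₃ t ((le_max_right _ _).trans (le_max_right _ _)))
  -- `u` is an order unit, so the functional `c u ↦ c` extends to one nonnegative on the cone
  obtain ⟨g, hg1, hg2⟩ := riesz_extension _ _ hnonneg hdense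
  have hgu : g u = 1 := by
    have h2 := hg1 ⟨u, Submodule.mem_span_singleton_self u⟩
    rw [LinearPMap.mkSpanSingleton_apply ℝ ℝ hu0] at h2
    exact h2
  have hgy : g y ≤ 0 := by
    have h2 := hg2 (-y) ⟨1, n, 0, 0, zero_le_one, by simp, by simp [matAct_zero],
      by simp [matAct_zero], by simp⟩
    rw [map_neg] at h2
    linarith
  refine ⟨g.comp (LinearMap.inl ℝ _ _), g.comp ((LinearMap.inr ℝ _ _).comp (LinearMap.inl ℝ _ _)),
    g.comp ((LinearMap.inr ℝ _ _).comp (LinearMap.inr ℝ _ _)), ?_, ?_, ?_, ?_, ?_⟩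
  · exact fun x hx => hg2 _ (hmem1 x hx 0 (zero_mem _) 0 (zero_mem _))
  · exact fun x hx => hg2 _ (hmem1 0 (zero_mem _) x hx 0 (zero_mem _))
  · exact fun h hh => hg2 _ (hmem1 0 (zero_mem _) 0 (zero_mem _) h hh)
  · intro r v γ hv
    have h2 := hg2 (-matAct γᴴ v γ, matAct γᴴ v γ, γᴴ * γ)
      ⟨0, r, v, γ, le_rfl, hv, by simp, by simp, by simp⟩
    have h3 : ((-matAct γᴴ v γ, matAct γᴴ v γ, γᴴ * γ) :
        Matrix (Fin n) (Fin n) V × Matrix (Fin n) (Fin n) V × Matrix (Fin n) (Fin n) ℂ) =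
        -LinearMap.inl ℝ _ _ (matAct γᴴ v γ) +
        LinearMap.inr ℝ _ _ (LinearMap.inl ℝ _ _ (matAct γᴴ v γ)) +
        LinearMap.inr ℝ _ _ (LinearMap.inr ℝ _ _ (γᴴ * γ)) := by simp
    rw [h3, map_add, map_add, map_neg] at h2
    simp only [LinearMap.comp_apply]
    linarith
  · rw [hy, map_add, map_smul, hgu, smul_eq_mul, mul_one] at hgy
    have h3 : ((-a, a, 1) :
        Matrix (Fin n) (Fin n) V × Matrix (Fin n) (Fin n) V × Matrix (Fin n) (Fin n) ℂ) =
        -LinearMap.inl ℝ _ _ a +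
        LinearMap.inr ℝ _ _ (LinearMap.inl ℝ _ _ a) +
        LinearMap.inr ℝ _ _ (LinearMap.inr ℝ _ _ 1) := by simp
    rw [h3, map_add, map_add, map_neg] at hgy
    simp only [LinearMap.comp_apply]
    linarith

end MatrixLipschitzSeminorm

/-! ### From positive functionals to completely positive maps -/

section toMap

variable {V : Type*} [AddCommGroup V] [Module ℂ V] [StarAddMonoid V] [StarModule ℂ V]
  {S : MatrixOrderUnitSpace V} {m n r : ℕ}

lemma isCompletelyPositive_of_re_nonneg {φ : V →ₗ[ℂ] Matrix (Fin n) (Fin n) ℂ}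
    (hφ : ∀ v, φ (star v) = (φ v)ᴴ)
    (h : ∀ (r : ℕ), ∀ a ∈ S.pos r, ∀ x, 0 ≤ (star x ⬝ᵥ matPairing φ a *ᵥ x).re) :
    S.IsCompletelyPositive φ := fun r a ha =>
  Matrix.posSemidef_of_re_nonneg
    (by rw [Matrix.IsHermitian, ← matPairing_conjTranspose hφ, (S.isHermitian_of_mem r a ha).eq])
    (h r a ha)

lemma map_conjTranspose_of_accretive_nonneg {f : Module.Dual ℝ (Matrix (Fin n) (Fin n) V)}
    (hf : ∀ x ∈ S.accretive n, 0 ≤ f x) (w : Matrix (Fin n) (Fin n) V) : f wᴴ = f w := by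
  have h1 := hf _ (S.sub_conjTranspose_mem_accretive w)
  have h2 := hf _ (S.sub_conjTranspose_mem_accretive wᴴ)
  rw [Matrix.conjTranspose_conjTranspose, map_sub] at h2
  rw [map_sub] at h1
  linarith

lemma isCompletelyPositive_toMap {f : Module.Dual ℝ (Matrix (Fin n) (Fin n) V)}
    (hf : ∀ x ∈ S.accretive n, 0 ≤ f x) : S.IsCompletelyPositive (toMap f) :=
  isCompletelyPositive_of_re_nonneg (toMap_star (map_conjTranspose_of_accretive_nonneg hf))
    fun r a ha x => by
      rw [re_dotProduct_matPairing_toMap]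
      exact hf _ (S.pos_le_accretive (S.conj_mem r n _ a ha))

lemma MatrixOrderUnitSpace.IsCompletelyPositive.conjMap
    {φ : V →ₗ[ℂ] Matrix (Fin n) (Fin n) ℂ} (hφ : S.IsCompletelyPositive φ)
    (C : Matrix (Fin n) (Fin m) ℂ) : S.IsCompletelyPositive (conjMap C φ) :=
  isCompletelyPositive_of_re_nonneg
    (fun v => by
      rw [conjMap_apply, conjMap_apply, hφ.map_star, Matrix.conjTranspose_mul,
        Matrix.conjTranspose_mul, Matrix.conjTranspose_conjTranspose, Matrix.mul_assoc])
    fun r a ha x => by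
      rw [dotProduct_matPairing_conjMap]
      exact (hφ r a ha).re_nonneg _

end toMap

section toMapScalar

variable {m n r : ℕ}

/-- A functional `p` on scalar matrices is given by the matrix `toMap p 1`. -/
lemma sum_re_dotProduct_toMap_one (p : Module.Dual ℝ (Matrix (Fin n) (Fin n) ℂ))
    (γ : Matrix (Fin r) (Fin n) ℂ) :
    ∑ k, (star (γ k) ⬝ᵥ toMap p 1 *ᵥ γ k).re = p (γᴴ * γ) := by
  have h := re_dotProduct_matPairing_toMap p (1 : Matrix (Fin r) (Fin r) ℂ) fun q => γ q.1 q.2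
  rw [matAct_scalar, Matrix.mul_one, dotProduct_matPairing_mulVec] at h
  have h2 : (Matrix.of fun k i => γ k i) = γ := rfl
  rw [h2] at h
  rw [← h, Complex.re_sum]
  refine Finset.sum_congr rfl fun k _ => ?_
  rw [Finset.sum_eq_single k]
  · rw [Matrix.one_apply_eq]
  · intro l _ hl
    rw [Matrix.one_apply_ne hl.symm, map_zero, Matrix.zero_mulVec, dotProduct_zero]
  · simp

lemma posSemidef_toMap_one {p : Module.Dual ℝ (Matrix (Fin n) (Fin n) ℂ)}
    (hp : ∀ h ∈ accretiveMat n, 0 ≤ p h) : (toMap p 1).PosSemidef := by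
  have h1 : ∀ w, p wᴴ = p w := by
    intro w
    have h1 := hp (w - wᴴ) (by rw [mem_accretiveMat]; simp [Matrix.PosSemidef.zero])
    have h2 := hp (wᴴ - w) (by rw [mem_accretiveMat]; simp [Matrix.PosSemidef.zero])
    rw [map_sub] at h1 h2
    linarith
  refine Matrix.posSemidef_of_re_nonneg ?_ fun x => ?_
  · rw [Matrix.IsHermitian, ← toMap_star h1, star_one]
  · have h2 := sum_re_dotProduct_toMap_one p (Matrix.of fun _ : Fin 1 => x)
    rw [Fin.sum_univ_one] at h2
    have h3 := hp _ (posSemidef_mem_accretiveMat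
      (Matrix.posSemidef_conjTranspose_mul_self (Matrix.of fun _ : Fin 1 => x)))
    rw [← h2] at h3
    exact h3

lemma exists_eq_conjTranspose_mul_self {P : Matrix (Fin n) (Fin n) ℂ} (hP : P.PosDef) :
    ∃ B C : Matrix (Fin n) (Fin n) ℂ, P = Bᴴ * B ∧ B * C = 1 := by
  open scoped MatrixOrder in
  obtain ⟨B, hB⟩ := CStarAlgebra.nonneg_iff_eq_star_mul_self.mp hP.posSemidef.nonneg
  have hu : IsUnit B.det := by
    have := hP.isUnit
    rw [hB, Matrix.isUnit_iff_isUnit_det, Matrix.det_mul] at this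
    exact isUnit_of_mul_isUnit_right this
  exact ⟨B, B⁻¹, hB, Matrix.mul_nonsing_inv B hu⟩

lemma norm_sq_toLp_eq_sum (x : Fin r × Fin n → ℂ) :
    ‖WithLp.toLp 2 x‖ ^ 2 = ∑ k, ‖WithLp.toLp 2 fun i => x (k, i)‖ ^ 2 := by
  simp [EuclideanSpace.norm_sq_eq, Fintype.sum_prod_type]

end toMapScalar

namespace MatrixLipschitzSeminorm

variable {V : Type*} [AddCommGroup V] [Module ℂ V] [StarAddMonoid V] [StarModule ℂ V]
  {S : MatrixOrderUnitSpace V} (𝓛 : MatrixLipschitzSeminorm S) {n : ℕ}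

/-- An element `a` with `L(a) > 1` is separated from the matrix unit ball of `L` by a difference of
completely positive maps. -/
theorem exists_separating_cp_maps (h𝓛 : 𝓛.IsLowerSemicontinuous)
    {a : Matrix (Fin n) (Fin n) V} (h1 : 1 < 𝓛.L n a) :
    ∃ (m : ℕ) (Φ₁ Φ₂ : V →ₗ[ℂ] Matrix (Fin m) (Fin m) ℂ), 0 < m ∧
      S.IsCompletelyPositive Φ₁ ∧ S.IsCompletelyPositive Φ₂ ∧
      (∀ (r : ℕ) (v : Matrix (Fin r) (Fin r) V), 𝓛.L r v ≤ 1 →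
        ‖matPairing (Φ₁ - Φ₂) v‖ ≤ 1) ∧ 1 < ‖matPairing (Φ₁ - Φ₂) a‖ := by
  have hn : 0 < n := by
    rcases Nat.eq_zero_or_pos n with rfl | h
    · rw [Subsingleton.elim a 0, map_zero] at h1
      linarith
    · exact h
  obtain ⟨f₁, f₂, p, hf₁, hf₂, hp, hle, hlt⟩ := 𝓛.exists_separating_functionals h𝓛
    (Nat.add_pos_left hn n) (isHermitian_offDiag a) (by rwa [𝓛.L_offDiag])
  -- a small multiple of the trace makes `p` faithful, without spoiling the strict inequality
  obtain ⟨δ, hδ, hδ'⟩ : ∃ δ : ℝ, 0 < δ ∧ p 1 + δ * (n + n) < f₁ (offDiag a) - f₂ (offDiag a) := by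
    have hn' : (0 : ℝ) < n + n := by positivity
    refine ⟨(f₁ (offDiag a) - f₂ (offDiag a) - p 1) / (n + n) / 2,
      by have := sub_pos.2 hlt; positivity, ?_⟩
    have : (f₁ (offDiag a) - f₂ (offDiag a) - p 1) / (n + n) / 2 * (n + n) =
      (f₁ (offDiag a) - f₂ (offDiag a) - p 1) / 2 := by field_simp
    rw [this]
    linarith
  have hPos : (toMap p 1 + (δ : ℂ) • (1 : Matrix (Fin (n + n)) (Fin (n + n)) ℂ)).PosDef :=
    Matrix.PosDef.posSemidef_add (posSemidef_toMap_one hp)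
      (Matrix.PosDef.one.smul (by exact_mod_cast hδ))
  obtain ⟨B, C, hB, hBC⟩ := exists_eq_conjTranspose_mul_self hPos
  -- the quadratic form of the perturbed density matrix
  have hq : ∀ ξ : Fin (n + n) → ℂ, (star ξ ⬝ᵥ toMap p 1 *ᵥ ξ).re + δ * ‖WithLp.toLp 2 ξ‖ ^ 2 =
      ‖WithLp.toLp 2 (B *ᵥ ξ)‖ ^ 2 := by
    intro ξ
    have h2 : star ξ ⬝ᵥ (Bᴴ * B) *ᵥ ξ = star (B *ᵥ ξ) ⬝ᵥ (B *ᵥ ξ) := by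
      rw [← Matrix.mulVec_mulVec, Matrix.dotProduct_mulVec, Matrix.star_mulVec]
    rw [← Matrix.re_star_dotProduct_self, ← Matrix.re_star_dotProduct_self, ← h2, ← hB,
      Matrix.add_mulVec, dotProduct_add, Matrix.smul_mulVec, Matrix.one_mulVec, dotProduct_smul,
      Complex.add_re, smul_eq_mul, Complex.re_ofReal_mul]
  have hcp₁ := (isCompletelyPositive_toMap hf₁).conjMap C
  have hcp₂ := (isCompletelyPositive_toMap hf₂).conjMap C
  have hstar : ∀ v, (conjMap C (toMap f₁) - conjMap C (toMap f₂)) (star v) =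
      ((conjMap C (toMap f₁) - conjMap C (toMap f₂)) v)ᴴ := by
    intro v
    rw [LinearMap.sub_apply, LinearMap.sub_apply, hcp₁.map_star, hcp₂.map_star,
      Matrix.conjTranspose_sub]
  have hform : ∀ (r : ℕ) (v : Matrix (Fin r) (Fin r) V) (x : Fin r × Fin (n + n) → ℂ),
      (star x ⬝ᵥ matPairing (conjMap C (toMap f₁) - conjMap C (toMap f₂)) v *ᵥ x).re =
        f₁ (matAct (Matrix.of fun k => C *ᵥ fun j => x (k, j))ᴴ v
          (Matrix.of fun k => C *ᵥ fun j => x (k, j))) -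
        f₂ (matAct (Matrix.of fun k => C *ᵥ fun j => x (k, j))ᴴ v
          (Matrix.of fun k => C *ᵥ fun j => x (k, j))) := by
    intro r v x
    rw [matPairing_sub_left, Matrix.sub_mulVec, dotProduct_sub, Complex.sub_re,
      dotProduct_matPairing_conjMap, dotProduct_matPairing_conjMap, re_dotProduct_matPairing_toMap,
      re_dotProduct_matPairing_toMap]
  refine ⟨n + n, conjMap C (toMap f₁), conjMap C (toMap f₂), Nat.add_pos_left hn n, hcp₁, hcp₂,
    fun r v hv => ?_, ?_⟩
  · refine norm_matPairing_le_one_of_offDiag hstar v fun z => ?_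
    rw [hform]
    refine (hle _ _ _ (by rwa [𝓛.L_offDiag])).trans ?_
    rw [← sum_re_dotProduct_toMap_one, norm_sq_toLp_eq_sum]
    refine Finset.sum_le_sum fun k _ => ?_
    have h2 := hq (C *ᵥ fun j => z (k, j))
    rw [Matrix.mulVec_mulVec _ B C, hBC, Matrix.one_mulVec] at h2
    rw [← h2]
    have : 0 ≤ δ * ‖WithLp.toLp 2 (C *ᵥ fun j => z (k, j))‖ ^ 2 := by positivity
    exact le_add_of_nonneg_right this
  · have hCB : C * B = 1 := mul_eq_one_comm.1 hBC
    refine one_lt_norm_matPairing_of_offDiag hstar a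
      (fun q => (B *ᵥ (1 : Matrix (Fin (n + n)) (Fin (n + n)) ℂ) q.1) q.2) ?_
    have h2 : (Matrix.of fun k => C *ᵥ fun j =>
        (B *ᵥ (1 : Matrix (Fin (n + n)) (Fin (n + n)) ℂ) k) j) = 1 := by
      ext k i
      rw [Matrix.of_apply]
      show (C *ᵥ (B *ᵥ (1 : Matrix (Fin (n + n)) (Fin (n + n)) ℂ) k)) i = _
      rw [Matrix.mulVec_mulVec, hCB, Matrix.one_mulVec]
    have h3 : matAct (1 : Matrix (Fin (n + n)) (Fin (n + n)) ℂ)ᴴ (offDiag a) 1 = offDiag a := by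
      ext i j
      simp [matAct, Matrix.one_apply, ite_smul]
    rw [hform, h2, h3]
    refine lt_of_eq_of_lt ?_ hδ'
    have h4 := sum_re_dotProduct_toMap_one p (1 : Matrix (Fin (n + n)) (Fin (n + n)) ℂ)
    rw [Matrix.conjTranspose_one, Matrix.one_mul] at h4
    rw [norm_sq_toLp_eq_sum, ← h4]
    have h5 : ∀ k, ‖WithLp.toLp 2 ((1 : Matrix (Fin (n + n)) (Fin (n + n)) ℂ) k)‖ ^ 2 = 1 := by
      intro k
      rw [EuclideanSpace.norm_sq_eq, Finset.sum_eq_single k] <;> simp +contextual [eq_comm]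
    have h6 : δ * ((n : ℝ) + n) = ∑ k : Fin (n + n),
        δ * ‖WithLp.toLp 2 ((1 : Matrix (Fin (n + n)) (Fin (n + n)) ℂ) k)‖ ^ 2 := by
      simp only [h5, mul_one, Finset.sum_const, Finset.card_univ, Fintype.card_fin, nsmul_eq_mul]
      push_cast
      ring
    rw [h6, ← Finset.sum_add_distrib]
    refine Finset.sum_congr rfl fun k _ => ?_
    rw [hq ((1 : Matrix (Fin (n + n)) (Fin (n + n)) ℂ) k)]

/-- The unit ball of `L` contains all multiples of the unit, so that a map bounded there vanishes
at the unit. -/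
lemma map_one_eq_zero {m : ℕ} {Φ : V →ₗ[ℂ] Matrix (Fin m) (Fin m) ℂ}
    (hΦ : ∀ (r : ℕ) (v : Matrix (Fin r) (Fin r) V), 𝓛.L r v ≤ 1 → ‖matPairing Φ v‖ ≤ 1) :
    Φ S.one = 0 := by
  have h0 : 𝓛.L 1 (S.unit 1) = 0 := (𝓛.eq_zero_iff 1 _).2 ⟨1, (S.scal_one).symm⟩
  have h1 : ‖matPairing Φ (S.unit 1)‖ = 0 := by
    by_contra hne
    have hpos : 0 < ‖matPairing Φ (S.unit 1)‖ := lt_of_le_of_ne (norm_nonneg _) (Ne.symm hne)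
    have h2 := hΦ 1 (((2 / ‖matPairing Φ (S.unit 1)‖ : ℝ) : ℂ) • S.unit 1)
      (by rw [map_smul_eq_mul, h0]; simp)
    rw [matPairing_smul, norm_smul, Complex.norm_real, Real.norm_of_nonneg (by positivity),
      div_mul_cancel₀ _ hne] at h2
    linarith
  rw [norm_eq_zero] at h1
  ext i j
  simpa [matPairing, MatrixOrderUnitSpace.unit] using congrFun (congrFun h1 (0, i)) (0, j)

end MatrixLipschitzSeminorm

/-! ### Normalization to matrix states -/

namespace MatrixOrderUnitSpace

variable {V : Type*} [AddCommGroup V] [Module ℂ V] [StarAddMonoid V] [StarModule ℂ V]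
  {S : MatrixOrderUnitSpace V} {m n r : ℕ}

/-- The map `v ↦ tr(Φ(v)) q`. -/
noncomputable def traceMap (Φ : V →ₗ[ℂ] Matrix (Fin m) (Fin m) ℂ) (q : Matrix (Fin n) (Fin n) ℂ) :
    V →ₗ[ℂ] Matrix (Fin n) (Fin n) ℂ :=
  ((Matrix.traceLinearMap (Fin m) ℂ ℂ).comp Φ).smulRight q

omit [StarAddMonoid V] [StarModule ℂ V] in
lemma traceMap_apply (Φ : V →ₗ[ℂ] Matrix (Fin m) (Fin m) ℂ) (q : Matrix (Fin n) (Fin n) ℂ) (v : V) :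
    traceMap Φ q v = (Φ v).trace • q := rfl

open scoped Kronecker in
lemma IsCompletelyPositive.traceMap {Φ : V →ₗ[ℂ] Matrix (Fin m) (Fin m) ℂ}
    (hΦ : S.IsCompletelyPositive Φ) {q : Matrix (Fin n) (Fin n) ℂ} (hq : q.PosSemidef) :
    S.IsCompletelyPositive (traceMap Φ q) := by
  intro r a ha
  have h : matPairing (MatrixOrderUnitSpace.traceMap Φ q) a =
      (∑ i, (matPairing Φ a).submatrix (fun k => (k, i)) (fun k => (k, i))) ⊗ₖ q := by
    ext ⟨k, i⟩ ⟨l, j⟩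
    simp [matPairing, traceMap_apply, Matrix.trace, Matrix.sum_apply]
  rw [h]
  exact (Matrix.posSemidef_sum _ fun i _ => (hΦ r a ha).submatrix _).kronecker hq

lemma IsCompletelyPositive.add {φ ψ : V →ₗ[ℂ] Matrix (Fin n) (Fin n) ℂ}
    (hφ : S.IsCompletelyPositive φ) (hψ : S.IsCompletelyPositive ψ) :
    S.IsCompletelyPositive (φ + ψ) := fun r a ha => by
  rw [matPairing_add_left]
  exact (hφ r a ha).add (hψ r a ha)

lemma IsCompletelyPositive.smul {φ : V →ₗ[ℂ] Matrix (Fin n) (Fin n) ℂ}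
    (hφ : S.IsCompletelyPositive φ) {t : ℝ} (ht : 0 ≤ t) :
    S.IsCompletelyPositive ((t : ℂ) • φ) := fun r a ha => by
  rw [matPairing_smul_left]
  exact (hφ r a ha).smul (by exact_mod_cast ht)

lemma IsCompletelyPositive.posSemidef_map_one {φ : V →ₗ[ℂ] Matrix (Fin n) (Fin n) ℂ}
    (hφ : S.IsCompletelyPositive φ) : (φ S.one).PosSemidef :=
  (hφ 1 _ S.one_pos).submatrix fun i => ((0 : Fin 1), i)

/-- Completely positive maps with the same value at the unit become multiples of matrix states when
the same completely positive map is added to both. -/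
theorem exists_matrixState_sub_eq (hn : 0 < n) {Φ₁ Φ₂ : V →ₗ[ℂ] Matrix (Fin n) (Fin n) ℂ}
    (h₁ : S.IsCompletelyPositive Φ₁) (h₂ : S.IsCompletelyPositive Φ₂)
    (hone : Φ₁ S.one = Φ₂ S.one) (hne : Φ₁ ≠ Φ₂) :
    ∃ (T : ℝ) (φ ψ : S.MatrixState n), 0 < T ∧ Φ₁ - Φ₂ = (T : ℂ) • (φ.1 - ψ.1) := by
  set b := Φ₁ S.one with hb
  have hbps : b.PosSemidef := h₁.posSemidef_map_one
  have htr : b.trace ≠ 0 := by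
    intro h
    have hb0 : b = 0 := hbps.trace_eq_zero_iff.1 h
    have hz : ∀ {Φ : V →ₗ[ℂ] Matrix (Fin n) (Fin n) ℂ}, S.IsCompletelyPositive Φ →
        Φ S.one = 0 → Φ = 0 := by
      intro Φ hΦ h0
      ext v i j
      exact congrFun (congrFun (hΦ.matPairing_eq_zero h0 (Matrix.of fun _ _ : Fin 1 => v)) (0, i))
        (0, j)
    exact hne ((hz h₁ (hb.symm.trans hb0)).trans (hz h₂ (hone.symm.trans hb0)).symm)
  have htrpos : 0 ≤ b.trace := hbps.trace_nonneg
  obtain ⟨s, hs⟩ : ∃ s : ℝ, b.trace = (s : ℂ) := ⟨b.trace.re, Complex.eq_re_of_ofReal_le htrpos⟩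
  have hs0 : 0 ≤ s := by rw [hs] at htrpos; exact_mod_cast htrpos
  have hs' : (s : ℂ) ≠ 0 := hs ▸ htr
  set T : ℝ := ‖b‖ + 1 with hT
  have hTpos : 0 < T := by positivity
  have hT' : (T : ℂ) ≠ 0 := by exact_mod_cast hTpos.ne'
  set q : Matrix (Fin n) (Fin n) ℂ := (T : ℂ) • 1 - b with hq
  have hqps : q.PosSemidef := Matrix.posSemidef_smul_one_sub hbps.isHermitian (by rw [hT]; linarith)
  -- the state `v ↦ tr(Φ₁(v)) / tr(b)` carries the missing mass `q = T - b`
  set R : V →ₗ[ℂ] Matrix (Fin n) (Fin n) ℂ := ((s⁻¹ : ℝ) : ℂ) • MatrixOrderUnitSpace.traceMap Φ₁ q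
    with hR
  have hRcp : S.IsCompletelyPositive R := (h₁.traceMap hqps).smul (inv_nonneg.2 hs0)
  have hRone : R S.one = q := by
    rw [hR, LinearMap.smul_apply, traceMap_apply, ← hb, hs, smul_smul]
    push_cast
    rw [inv_mul_cancel₀ hs', one_smul]
  have hstate : ∀ Φ : V →ₗ[ℂ] Matrix (Fin n) (Fin n) ℂ, S.IsCompletelyPositive Φ → Φ S.one = b →
      S.IsCompletelyBounded (((T⁻¹ : ℝ) : ℂ) • (Φ + R)) ∧
      S.IsCompletelyPositive (((T⁻¹ : ℝ) : ℂ) • (Φ + R)) ∧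
      (((T⁻¹ : ℝ) : ℂ) • (Φ + R)) S.one = 1 := by
    intro Φ hΦ hΦ1
    have hcp := (hΦ.add hRcp).smul (inv_nonneg.2 hTpos.le)
    have h1 : (((T⁻¹ : ℝ) : ℂ) • (Φ + R)) S.one = 1 := by
      rw [LinearMap.smul_apply, LinearMap.add_apply, hΦ1, hRone, hq, add_sub_cancel, smul_smul]
      push_cast
      rw [inv_mul_cancel₀ hT', one_smul]
    exact ⟨hcp.isCompletelyBounded hn h1, hcp, h1⟩
  refine ⟨T, ⟨_, hstate Φ₁ h₁ rfl⟩, ⟨_, hstate Φ₂ h₂ hone.symm⟩, hTpos, ?_⟩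
  show _ = (T : ℂ) • (((T⁻¹ : ℝ) : ℂ) • (Φ₁ + R) - ((T⁻¹ : ℝ) : ℂ) • (Φ₂ + R))
  rw [smul_sub, smul_smul, smul_smul, ← Complex.ofReal_mul, mul_inv_cancel₀ hTpos.ne',
    Complex.ofReal_one, one_smul, one_smul]
  abel

end MatrixOrderUnitSpace

/-! ### Recovering the seminorm from its metric -/

namespace MatrixLipschitzSeminorm

variable {V : Type*} [AddCommGroup V] [Module ℂ V] [StarAddMonoid V] [StarModule ℂ V]
  {S : MatrixOrderUnitSpace V} (𝓛 : MatrixLipschitzSeminorm S) {n r : ℕ}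

lemma enorm_sub_le_mul_matrixMetric (φ ψ : S.MatrixState r) {a : Matrix (Fin n) (Fin n) V} {c : ℝ}
    (hc : 0 < c) (ha : 𝓛.L n a ≤ c) :
    ‖matPairing φ.1 a - matPairing ψ.1 a‖ₑ ≤ ENNReal.ofReal c * 𝓛.matrixMetric r φ ψ := by
  have h1 : 𝓛.L n (((c⁻¹ : ℝ) : ℂ) • a) ≤ 1 := by
    rw [map_smul_eq_mul, Complex.norm_real, Real.norm_of_nonneg (inv_nonneg.2 hc.le),
      inv_mul_le_iff₀ hc, mul_one]
    exact ha
  have h2 : ‖matPairing φ.1 (((c⁻¹ : ℝ) : ℂ) • a) - matPairing ψ.1 (((c⁻¹ : ℝ) : ℂ) • a)‖ₑ ≤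
      𝓛.matrixMetric r φ ψ := le_iSup₂_of_le n _ (le_iSup_of_le h1 le_rfl)
  have h3 : matPairing φ.1 a - matPairing ψ.1 a = (c : ℂ) •
      (matPairing φ.1 (((c⁻¹ : ℝ) : ℂ) • a) - matPairing ψ.1 (((c⁻¹ : ℝ) : ℂ) • a)) := by
    rw [matPairing_smul, matPairing_smul, ← smul_sub, smul_smul, ← Complex.ofReal_mul,
      mul_inv_cancel₀ hc.ne', Complex.ofReal_one, one_smul]
  rw [h3, enorm_smul]
  have h4 : ‖(c : ℂ)‖ₑ = ENNReal.ofReal c := by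
    rw [← ofReal_norm, Complex.norm_real, Real.norm_of_nonneg hc.le]
  rw [h4]
  gcongr

lemma lipGauge_matrixMetric_le (a : Matrix (Fin n) (Fin n) V) :
    S.lipGauge 𝓛.matrixMetric n a ≤ ENNReal.ofReal (𝓛.L n a) := by
  refine iSup_le fun r => iSup_le fun φ => iSup_le fun ψ => iSup_le fun _ => ?_
  refine ENNReal.le_of_forall_pos_le_add fun ε hε _ => ?_
  have hc : 0 < 𝓛.L n a + ε := add_pos_of_nonneg_of_pos (apply_nonneg _ _) (by exact_mod_cast hε)
  refine (ENNReal.div_le_of_le_mul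
    (𝓛.enorm_sub_le_mul_matrixMetric φ ψ hc (by simp))).trans (le_of_eq ?_)
  rw [ENNReal.ofReal_add (apply_nonneg _ _) (by positivity), ENNReal.ofReal_coe_nnreal]

lemma one_le_lipGauge_matrixMetric (h𝓛 : 𝓛.IsLowerSemicontinuous) {a : Matrix (Fin n) (Fin n) V}
    (ha : 1 < 𝓛.L n a) : 1 ≤ S.lipGauge 𝓛.matrixMetric n a := by
  obtain ⟨m, Φ₁, Φ₂, hm, h₁, h₂, hball, hlt⟩ := 𝓛.exists_separating_cp_maps h𝓛 ha
  have hone : Φ₁ S.one = Φ₂ S.one := sub_eq_zero.1 (𝓛.map_one_eq_zero hball)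
  have hne : Φ₁ ≠ Φ₂ := by
    rintro rfl
    rw [matPairing_sub_left, sub_self, norm_zero] at hlt
    linarith
  obtain ⟨T, φ, ψ, hT, h⟩ := MatrixOrderUnitSpace.exists_matrixState_sub_eq hm h₁ h₂ hone hne
  have hscale : ∀ (r : ℕ) (v : Matrix (Fin r) (Fin r) V),
      ‖matPairing (Φ₁ - Φ₂) v‖ = T * ‖matPairing φ.1 v - matPairing ψ.1 v‖ := by
    intro r v
    rw [h, matPairing_smul_left, matPairing_sub_left, norm_smul, Complex.norm_real,
      Real.norm_of_nonneg hT.le]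
  have hφψ : φ ≠ ψ := by
    rintro rfl
    rw [hscale, sub_self, norm_zero] at hlt
    linarith
  have hD : 𝓛.matrixMetric m φ ψ ≤ ENNReal.ofReal T⁻¹ := by
    refine iSup_le fun r => iSup_le fun v => iSup_le fun hv => ?_
    rw [← ofReal_norm]
    refine ENNReal.ofReal_le_ofReal ?_
    have h2 := hball r v hv
    rw [hscale] at h2
    rwa [← one_div, le_div_iff₀' hT]
  have hA : ENNReal.ofReal T⁻¹ ≤ ‖matPairing φ.1 a - matPairing ψ.1 a‖ₑ := by
    rw [← ofReal_norm]
    refine ENNReal.ofReal_le_ofReal ?_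
    rw [hscale] at hlt
    rw [← one_div, div_le_iff₀' hT]
    exact hlt.le
  have h0 : ENNReal.ofReal T⁻¹ ≠ 0 := by simpa using hT
  calc (1 : ℝ≥0∞) = ENNReal.ofReal T⁻¹ / ENNReal.ofReal T⁻¹ :=
        (ENNReal.div_self h0 ENNReal.ofReal_ne_top).symm
    _ ≤ ‖matPairing φ.1 a - matPairing ψ.1 a‖ₑ / 𝓛.matrixMetric m φ ψ := ENNReal.div_le_div hA hD
    _ ≤ S.lipGauge 𝓛.matrixMetric n a :=
        le_iSup₂_of_le m φ (le_iSup₂_of_le ψ hφψ le_rfl)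

end MatrixLipschitzSeminorm

lemma MatrixOrderUnitSpace.lipGauge_smul_le {V : Type*} [AddCommGroup V] [Module ℂ V]
    [StarAddMonoid V] [StarModule ℂ V] (S : MatrixOrderUnitSpace V)
    (D : (r : ℕ) → S.MatrixState r → S.MatrixState r → ℝ≥0∞) {n : ℕ} (c : ℂ)
    (a : Matrix (Fin n) (Fin n) V) : S.lipGauge D n (c • a) ≤ ‖c‖ₑ * S.lipGauge D n a := by
  refine iSup_le fun r => iSup_le fun φ => iSup_le fun ψ => iSup_le fun h => ?_
  rw [matPairing_smul, matPairing_smul, ← smul_sub, enorm_smul, mul_div_assoc]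
  gcongr
  exact le_iSup₂_of_le r φ (le_iSup₂_of_le ψ h le_rfl)

theorem theorem4p4 {V : Type*} [AddCommGroup V] [Module ℂ V] [StarAddMonoid V] [StarModule ℂ V]
    (S : MatrixOrderUnitSpace V) (𝓛 : MatrixLipschitzSeminorm S)
    (h𝓛 : 𝓛.IsLowerSemicontinuous) :
    ∀ (n : ℕ) (a : Matrix (Fin n) (Fin n) V),
      S.lipGauge 𝓛.matrixMetric n a = ENNReal.ofReal (𝓛.L n a) := by
  intro n a
  refine le_antisymm (𝓛.lipGauge_matrixMetric_le a) (le_of_forall_lt fun z hz => ?_)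
  -- rescale so that `a` lies just outside the unit ball of `L`
  obtain ⟨y, hzy, hya⟩ := exists_between hz
  have hytop : y ≠ ⊤ := (hya.trans_le le_top).ne
  have hy0 : 0 < y.toReal := ENNReal.toReal_pos (pos_of_gt hzy).ne' hytop
  have hyL : y.toReal < 𝓛.L n a := by
    rw [ENNReal.lt_ofReal_iff_toReal_lt hytop] at hya
    exact hya
  refine hzy.trans_le ?_
  have h1 : 1 < 𝓛.L n (((y.toReal⁻¹ : ℝ) : ℂ) • a) := by
    rw [map_smul_eq_mul, Complex.norm_real, Real.norm_of_nonneg (inv_nonneg.2 hy0.le),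
      lt_inv_mul_iff₀ hy0, mul_one]
    exact hyL
  have h2 := (𝓛.one_le_lipGauge_matrixMetric h𝓛 h1).trans (S.lipGauge_smul_le _ _ _)
  rw [← ofReal_norm, Complex.norm_real, Real.norm_of_nonneg (inv_nonneg.2 hy0.le),
    ENNReal.ofReal_inv_of_pos hy0, ENNReal.ofReal_toReal hytop, mul_comm, ← div_eq_mul_inv] at h2
  simpa using ENNReal.mul_le_of_le_div h2
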